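/- Fix $k\ge 2$ packet lengths $0<\ell_1<\ell_2<\dots<\ell_k$ and put $\rho_{i,j}=\ell_i/\ell_j$. Model. A sender transmits packets over one link at unit rate, so that a packet of length $\ell_i$ takes time $\ell_i$. An arrival pattern $\mathcal A$ prescribes at which times $t\ge 0$ how many packets of each length arrive in the (unbounded) queue of the sender, finitely many in bounded time; an error pattern $\mathcal E$ is a set of times $t\ge 0$ of jamming errors, finitely many in bounded time. A schedule for $(\mathcal A,\mathcal E)$ determines when the transmission of a packet of which length is started. The packet must be waiting in the queue (arrived and not yet successfully transmitted), and only one packet is transmitted at a time: a transmission ends only by being completed or by an error. A transmission of an $\ell_i$-packet started at time $s$ is successful if no error occurs in $(s,s+\ell_i)$; otherwise the first such error breaks it, the packet returns to the queue, and a new transmission may start at once. The sender may stay idle when it is not transmitting. Let $L_\sigma(\mathcal A,\mathcal E,t)$ be the total length of the packets successfully transmitted by time $t$ under the schedule $\sigma$. A (deterministic) online algorithm $ALG$ assigns to each pair $(\mathcal A,\mathcal E)$ a schedule such that what it starts at time $t$ depends only on the arrivals and errors up to and including time $t$. Its relative throughput is $$T_{ALG}=\inf_{\mathcal A,\mathcal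 E}\ \inf_{OFF}\ \liminf_{t\to\infty}\frac{L_{ALG}(\mathcal A,\mathcal E,t)}{L_{OFF}(\mathcal A,\mathcal E,t)},$$ where $OFF$ ranges over all schedules for $(\mathcal A,\mathcal E)$ such that $L_{OFF}(\mathcal A,\mathcal E,t)$ is unbounded as $t\to\infty$ (and $0/0=1$). Theorem. The optimal relative throughput of an online algorithm is $$\max_{ALG}T_{ALG}=\min_{1\le j<i\le k}\frac{\lfloor\rho_{i,j}\rfloor}{\lfloor\rho_{i,j}\rfloor+\rho_{i,j}}.$$ That is, no online algorithm has a larger relative throughput, and some online algorithm attains this value. -/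

import Mathlib

open scoped ENNReal

noncomputable section

namespace PacketScheduling

/-- An arrival pattern for `k` packet lengths: `count i t` packets of the `i`-th length arrive at
time `t`. Time starts at `0` and only finitely many packets arrive in bounded time. -/
structure ArrivalPattern (k : ℕ) where
  count : Fin k → ℝ → ℕ
  count_of_neg : ∀ i t, t < 0 → count i t = 0
  finite_le : ∀ i T, {t : ℝ | t ≤ T ∧ count i t ≠ 0}.Finite

/-- An error pattern: the set of times of the jamming errors. Time starts at `0` and only finitely
many errors occur in bounded time. -/
structure ErrorPattern where
  times : Set ℝ
  nonneg : ∀ e ∈ times, 0 ≤ e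
  finite_le : ∀ T : ℝ, {e : ℝ | e ≤ T ∧ e ∈ times}.Finite

/-- The number of packets of the `i`-th length that have arrived by time `t` (inclusive). -/
def ArrivalPattern.arrivedBy {k : ℕ} (A : ArrivalPattern k) (i : Fin k) (t : ℝ) : ℕ :=
  ∑ᶠ (s : ℝ) (_ : s ≤ t), A.count i s

/-- No error breaks a transmission that occupies the link from time `s` to time `s + len`. An error
at time `s` precedes the transmission (the sender may restart at the very moment of an error), and
an error at time `s + len` comes when the transmission is already complete. -/
def ErrorPattern.Clear (E : ErrorPattern) (s len : ℝ) : Prop :=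
  ∀ e ∈ E.times, ¬ (s < e ∧ e < s + len)

/-- The transmissions of a sender: `σ t = some i` means that at time `t` it starts to transmit a
packet of the `i`-th length, and `σ t = none` that it starts nothing at time `t`. -/
abbrev Starts (k : ℕ) := ℝ → Option (Fin k)

/-- The number of packets of the `i`-th length successfully transmitted by time `t`. -/
def sentBy {k : ℕ} (ℓ : Fin k → ℝ) (E : ErrorPattern) (σ : Starts k) (i : Fin k) (t : ℝ) : ℕ :=
  {s : ℝ | σ s = some i ∧ s + ℓ i ≤ t ∧ E.Clear s (ℓ i)}.ncard

/-- The total length of the packets successfully transmitted by time `t`. -/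
def throughput {k : ℕ} (ℓ : Fin k → ℝ) (E : ErrorPattern) (σ : Starts k) (t : ℝ) : ℝ :=
  ∑ i, ℓ i * (sentBy ℓ E σ i t : ℝ)

/-- `σ` is a schedule for the given arrival and error patterns. -/
structure IsSchedule {k : ℕ} (ℓ : Fin k → ℝ) (A : ArrivalPattern k) (E : ErrorPattern)
    (σ : Starts k) : Prop where
  /-- A packet whose transmission is started waits in the queue: it has arrived and has not been
  transmitted successfully. -/
  available : ∀ t i, σ t = some i → sentBy ℓ E σ i t < A.arrivedBy i t
  /-- One transmission at a time: a new transmission starts only after the earlier one is complete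
  or is broken by an error. -/
  sequential : ∀ s t i, s < t → σ s = some i → σ t ≠ none →
    s + ℓ i ≤ t ∨ ∃ e ∈ E.times, s < e ∧ e ≤ t

/-- A deterministic online algorithm: for all patterns it produces a schedule, and what it starts
at time `t` depends only on the arrivals and the errors up to time `t` (inclusive). -/
structure OnlineAlgorithm {k : ℕ} (ℓ : Fin k → ℝ) where
  run : ArrivalPattern k → ErrorPattern → Starts k
  isSchedule : ∀ A E, IsSchedule ℓ A E (run A E)
  causal : ∀ (A A' : ArrivalPattern k) (E E' : ErrorPattern) (t : ℝ),
    (∀ i, ∀ s ≤ t, A.count i s = A'.count i s) →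
    (∀ s ≤ t, s ∈ E.times ↔ s ∈ E'.times) →
    run A E t = run A' E' t

/-- The quotient of two throughputs `x, y ≥ 0`, equal to `1` if both vanish (and to `∞` if only `y`
vanishes). -/
def throughputRatio (x y : ℝ) : ℝ≥0∞ :=
  open Classical in
  if x = 0 ∧ y = 0 then 1 else ENNReal.ofReal x / ENNReal.ofReal y

/-- The relative throughput of an online algorithm: the infimum of the asymptotic ratio between its
throughput and that of an offline schedule, over all arrival and error patterns and all offline
schedules for these patterns whose throughput is unbounded. -/
def relativeThroughput {k : ℕ} (ℓ : Fin k → ℝ) (alg : OnlineAlgorithm ℓ) : ℝ≥0∞ :=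
  ⨅ (A : ArrivalPattern k) (E : ErrorPattern) (off : Starts k) (_ : IsSchedule ℓ A E off)
    (_ : ¬ BddAbove (Set.range (throughput ℓ E off))),
    Filter.liminf
      (fun t : ℝ => throughputRatio (throughput ℓ E (alg.run A E) t) (throughput ℓ E off t))
      Filter.atTop

end PacketScheduling

end

/-! Let `R` be the claimed minimum and `c = R / (1 - R)`, so that `R = c / (1 + c)`. Then `R` is
below the value of a pair `j < i` exactly when `c * ρ ≤ ⌊ρ⌋` with `ρ = ℓ i / ℓ j`.

Upper bound (`relativeThroughput_le`). For a pair `j < i` the adversary works in phases separated by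
errors. If the algorithm opens a phase with a long packet `i`, the phase lasts only `ℓ j`; otherwise
it lasts `ℓ i`. The algorithm never completes a long packet, gains nothing in short phases and sends
at most `⌊ρ⌋` short packets per long phase. Short packets are also scarce: one at the beginning and
one more after each short phase. The offline schedule fills every phase with one packet. Weighting
the two bounds on the short packets by `ρ` and `⌊ρ⌋` gives the ratio (`throughput_phase_le`).

Lower bound (`exists_le_relativeThroughput`). The algorithm sends blocks of `N j` packets of the
least length `j` with that many waiting, and abandons a block at an error. For every set `U` of
lengths, `c * OFF_U ≤ ALG + c * ALG_U + const` (`blockRun_competitive`); for all lengths together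
this is `c * OFF ≤ (1 + c) * ALG + const`. The proof is by induction on `U`. If some length of `U`
is scarce in the queue, the algorithm has sent almost all of its packets, and the length can be
removed from `U`. Otherwise the algorithm is busy with packets no longer than those in `U`, and
after each error it keeps up with factor `c`, without any additive loss (`CompetitiveAfter`). The
absence of loss is essential because the number of errors is unbounded; the block sizes of
`exists_block_sizes` ensure it. -/

namespace PacketScheduling

variable {k : ℕ} {ℓ : Fin k → ℝ} {A : ArrivalPattern k} {E : ErrorPattern} {σ : Starts k}

/-! ### Arrivals -/

lemma ArrivalPattern.arrivedBy_eq_sum (A : ArrivalPattern k) (i : Fin k) {t T : ℝ} (h : t ≤ T) :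
    A.arrivedBy i t = ∑ s ∈ (A.finite_le i T).toFinset with s ≤ t, A.count i s := by
  refine finsum_mem_eq_sum_of_inter_support_eq (s := Set.Iic t) _ ?_
  ext s
  simp only [Set.mem_inter_iff, Set.mem_Iic, Function.mem_support, Finset.coe_filter,
    Set.Finite.mem_toFinset, Set.mem_ofPred_eq]
  constructor
  · rintro ⟨h1, h2⟩
    exact ⟨⟨⟨h1.trans h, h2⟩, h1⟩, h2⟩
  · rintro ⟨⟨_, h1⟩, h2⟩
    exact ⟨h1, h2⟩

lemma ArrivalPattern.arrivedBy_mono (A : ArrivalPattern k) (i : Fin k) :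
    Monotone (A.arrivedBy i) := by
  intro t T h
  rw [A.arrivedBy_eq_sum i h, A.arrivedBy_eq_sum i le_rfl]
  refine Finset.sum_le_sum_of_subset fun s hs => ?_
  simp only [Finset.mem_filter, Set.Finite.mem_toFinset, Set.mem_ofPred_eq] at hs ⊢
  exact ⟨hs.1, hs.1.1⟩

lemma ArrivalPattern.arrivedBy_of_neg (A : ArrivalPattern k) (i : Fin k) {t : ℝ} (h : t < 0) :
    A.arrivedBy i t = 0 := by
  rw [A.arrivedBy_eq_sum i le_rfl]
  refine Finset.sum_eq_zero fun s hs => A.count_of_neg i s ?_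
  exact (Finset.mem_filter.1 hs).2.trans_lt h

lemma ArrivalPattern.arrivedBy_congr {A' : ArrivalPattern k} {t : ℝ} (i : Fin k)
    (h : ∀ s ≤ t, A.count i s = A'.count i s) : A.arrivedBy i t = A'.arrivedBy i t :=
  finsum_mem_congr (s := Set.Iic t) rfl fun s hs => h s hs

/-! ### Successful transmissions -/

lemma IsSchedule.start_nonneg (h : IsSchedule ℓ A E σ) {t : ℝ} {i : Fin k} (ht : σ t = some i) :
    0 ≤ t := by
  by_contra! hneg
  have := h.available t i ht
  rw [A.arrivedBy_of_neg i hneg] at this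
  omega

/-- An error that frees the link before `s + ℓ i` would break the transmission. -/
lemma IsSchedule.end_le_start (h : IsSchedule ℓ A E σ) {s t : ℝ} {i : Fin k} (hs : σ s = some i)
    (hc : E.Clear s (ℓ i)) (hst : s < t) (ht : σ t ≠ none) : s + ℓ i ≤ t := by
  rcases h.sequential s t i hst hs ht with h1 | ⟨e, he, h1, h2⟩
  · exact h1
  · by_contra! h3
    exact hc e he ⟨h1, by linarith⟩

/-- The starting times of the transmissions of packets of length `i` completed by time `t`. -/
def completed (ℓ : Fin k → ℝ) (E : ErrorPattern) (σ : Starts k) (i : Fin k) (t : ℝ) : Set ℝ :=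
  {s : ℝ | σ s = some i ∧ s + ℓ i ≤ t ∧ E.Clear s (ℓ i)}

lemma sentBy_eq_ncard (i : Fin k) (t : ℝ) :
    sentBy ℓ E σ i t = (completed ℓ E σ i t).ncard := rfl

lemma completed_mono (i : Fin k) : Monotone (completed ℓ E σ i) :=
  fun _ _ h _ hs => ⟨hs.1, hs.2.1.trans h, hs.2.2⟩

/-- `sentBy` is an `ncard`, which is `0` on infinite sets, so counting arguments need finiteness.
Starts of completed packets are at least `ℓ i` apart, hence `⌊s / ℓ i⌋₊` separates them. -/
lemma IsSchedule.finite_completed (hpos : ∀ i, 0 < ℓ i) (h : IsSchedule ℓ A E σ) (i : Fin k)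
    (t : ℝ) : (completed ℓ E σ i t).Finite := by
  have key : ∀ x ∈ completed ℓ E σ i t, ∀ y ∈ completed ℓ E σ i t, x < y →
      ⌊x / ℓ i⌋₊ < ⌊y / ℓ i⌋₊ := by
    intro x hx y hy hxy
    have h1 := h.end_le_start hx.1 hx.2.2 hxy (by rw [hy.1]; simp)
    have h2 : x / ℓ i + 1 ≤ y / ℓ i := by
      have := hpos i
      rw [div_add_one this.ne']
      gcongr
    rw [← Nat.succ_le_iff]
    have h3 := Nat.floor_mono h2
    rwa [Nat.floor_add_one (div_nonneg (h.start_nonneg hx.1) (hpos i).le)] at h3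
  refine Set.Finite.of_finite_image (f := fun s => ⌊s / ℓ i⌋₊)
    ((Set.finite_Iic ⌊t / ℓ i⌋₊).subset ?_) ?_
  · rintro _ ⟨s, hs, rfl⟩
    refine Nat.floor_mono ?_
    have := hpos i
    gcongr
    linarith [hs.2.1]
  · intro x hx y hy hxy
    rcases lt_trichotomy x y with h1 | h1 | h1
    · exact absurd hxy (key x hx y hy h1).ne
    · exact h1
    · exact absurd hxy (key y hy x hx h1).ne'

lemma IsSchedule.sentBy_mono (hpos : ∀ i, 0 < ℓ i) (h : IsSchedule ℓ A E σ) (i : Fin k) :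
    Monotone (sentBy ℓ E σ i) :=
  fun _ t hst => Set.ncard_le_ncard (completed_mono i hst) (h.finite_completed hpos i t)

/-- When the last of the completed packets was started, all the others were already complete and it
was still waiting. -/
lemma IsSchedule.sentBy_le_arrivedBy (hpos : ∀ i, 0 < ℓ i) (h : IsSchedule ℓ A E σ) (i : Fin k)
    (t : ℝ) : sentBy ℓ E σ i t ≤ A.arrivedBy i t := by
  rcases (completed ℓ E σ i t).eq_empty_or_nonempty with h0 | hne
  · rw [sentBy_eq_ncard, h0]
    simp
  obtain ⟨m, hm, hmax⟩ := Set.exists_max_image _ id (h.finite_completed hpos i t) hne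
  have hsub : completed ℓ E σ i t ⊆ insert m (completed ℓ E σ i m) := by
    intro s hs
    rcases (hmax s hs).eq_or_lt with h1 | h1
    · exact Or.inl h1
    · exact Or.inr ⟨hs.1, h.end_le_start hs.1 hs.2.2 h1 (by rw [hm.1]; simp), hs.2.2⟩
  have h1 : sentBy ℓ E σ i t ≤ sentBy ℓ E σ i m + 1 :=
    (Set.ncard_le_ncard hsub ((h.finite_completed hpos i m).insert m)).trans
      (Set.ncard_insert_le _ _)
  have h2 := h.available m i hm.1
  have h3 := A.arrivedBy_mono i (show m ≤ t by linarith [hm.2.1, hpos i])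
  omega

/-- The number of packets of length `i` completed after time `x` and by time `y`. -/
noncomputable def sentIn (ℓ : Fin k → ℝ) (E : ErrorPattern) (σ : Starts k) (i : Fin k) (x y : ℝ) : ℕ :=
  sentBy ℓ E σ i y - sentBy ℓ E σ i x

lemma IsSchedule.sentBy_add_sentIn (hpos : ∀ i, 0 < ℓ i) (h : IsSchedule ℓ A E σ) (i : Fin k)
    {x y : ℝ} (hxy : x ≤ y) :
    sentBy ℓ E σ i x + sentIn ℓ E σ i x y = sentBy ℓ E σ i y :=
  Nat.add_sub_cancel' (h.sentBy_mono hpos i hxy)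

/-- Induction on the latest start `a`: all earlier packets of `F` are complete by time `a`. -/
lemma IsSchedule.sum_length_le (h : IsSchedule ℓ A E σ) {z : ℝ} (F : Finset ℝ) :
    ∀ y, z ≤ y →
    (∀ s ∈ F, z ≤ s ∧ ∃ i, σ s = some i ∧ s + ℓ i ≤ y ∧ E.Clear s (ℓ i)) →
    ∑ s ∈ F, (σ s).elim 0 ℓ ≤ y - z := by
  induction F using Finset.induction_on_max with
  | empty =>
    intro y hzy _
    simpa using hzy
  | insert a F hF ih =>
    intro y hzy hs
    obtain ⟨hza, i, hai, hay, hac⟩ := hs a (Finset.mem_insert_self _ _)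
    rw [Finset.sum_insert fun hmem => (hF a hmem).false, hai]
    have := ih a hza fun s hsF => by
      obtain ⟨h1, j, h2, h3, h4⟩ := hs s (Finset.mem_insert_of_mem hsF)
      exact ⟨h1, j, h2, h.end_le_start h2 h4 (hF s hsF) (by rw [hai]; simp), h4⟩
    simp only [Option.elim_some]
    linarith

/-- The packets completed in a time window occupy disjoint time intervals. -/
lemma IsSchedule.sum_sentIn_le (hpos : ∀ i, 0 < ℓ i) (h : IsSchedule ℓ A E σ) (U : Finset (Fin k))
    {x y z : ℝ} (hzy : z ≤ y)
    (hz : ∀ s i, σ s = some i → x < s + ℓ i → E.Clear s (ℓ i) → z ≤ s) :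
    ∑ i ∈ U, ℓ i * (sentIn ℓ E σ i x y : ℝ) ≤ y - z := by
  classical
  set D : Fin k → Finset ℝ := fun i =>
    ((h.finite_completed hpos i y).sdiff (t := completed ℓ E σ i x)).toFinset with hD
  have hmem : ∀ i s, s ∈ D i ↔ s ∈ completed ℓ E σ i y ∧ s ∉ completed ℓ E σ i x := by
    intro i s
    simp [hD]
  have hcard : ∀ i, sentIn ℓ E σ i x y ≤ (D i).card := by
    intro i
    rw [hD, ← Set.ncard_eq_toFinset_card _ _]
    exact Set.le_ncard_sdiff _ _ (h.finite_completed hpos i x)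
  have hdisj : Set.PairwiseDisjoint (U : Set (Fin k)) D := by
    intro i _ j _ hij
    refine Finset.disjoint_left.2 fun s hs hs' => hij ?_
    have h1 := ((hmem i s).1 hs).1.1
    have h2 := ((hmem j s).1 hs').1.1
    simpa [h1] using h2
  calc ∑ i ∈ U, ℓ i * (sentIn ℓ E σ i x y : ℝ)
      ≤ ∑ i ∈ U, ∑ s ∈ D i, (σ s).elim 0 ℓ := by
        refine Finset.sum_le_sum fun i _ => ?_
        rw [Finset.sum_congr rfl (g := fun _ => ℓ i), Finset.sum_const, nsmul_eq_mul, mul_comm]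
        · have := hpos i
          gcongr
          exact hcard i
        · intro s hs
          rw [((hmem i s).1 hs).1.1]
          rfl
    _ = ∑ s ∈ U.biUnion D, (σ s).elim 0 ℓ := (Finset.sum_biUnion hdisj).symm
    _ ≤ y - z := by
        refine h.sum_length_le _ y hzy fun s hs => ?_
        obtain ⟨i, _, hi⟩ := Finset.mem_biUnion.1 hs
        obtain ⟨h1, h2⟩ := (hmem i s).1 hi
        refine ⟨hz s i h1.1 ?_ h1.2.2, i, h1⟩
        by_contra! h3
        exact h2 ⟨h1.1, h3, h1.2.2⟩

/-- An error at `x` breaks whatever is under way, so no completed packet straddles `x`. -/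
lemma IsSchedule.sum_sentIn_le_of_fresh (hpos : ∀ i, 0 < ℓ i) (h : IsSchedule ℓ A E σ)
    (U : Finset (Fin k)) {x y : ℝ} (hxy : x ≤ y) (hx : x ≤ 0 ∨ x ∈ E.times) :
    ∑ i ∈ U, ℓ i * (sentIn ℓ E σ i x y : ℝ) ≤ y - x := by
  refine h.sum_sentIn_le hpos U hxy fun s i hs hlt hc => ?_
  rcases hx with hx | hx
  · exact hx.trans (h.start_nonneg hs)
  · by_contra! h1
    exact hc x hx ⟨h1, hlt⟩

/-- A packet straddling `x` was started after `x - M`; this costs the extra `M`. -/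
lemma IsSchedule.sum_sentIn_le_add (hpos : ∀ i, 0 < ℓ i) (h : IsSchedule ℓ A E σ)
    (U : Finset (Fin k)) {x y M : ℝ} (hM : 0 ≤ M) (hle : ∀ i, ℓ i ≤ M) (hxy : x ≤ y) :
    ∑ i ∈ U, ℓ i * (sentIn ℓ E σ i x y : ℝ) ≤ y - x + M := by
  have := h.sum_sentIn_le hpos U (x := x) (y := y) (z := x - M) (by linarith)
    fun s i _ hlt _ => by linarith [hle i]
  linarith

lemma IsSchedule.sentBy_nonpos (hpos : ∀ i, 0 < ℓ i) (h : IsSchedule ℓ A E σ) (i : Fin k)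
    {t : ℝ} (ht : t ≤ 0) : sentBy ℓ E σ i t = 0 := by
  rw [sentBy_eq_ncard, Set.ncard_eq_zero (h.finite_completed hpos i t),
    Set.eq_empty_iff_forall_notMem]
  intro s hs
  linarith [h.start_nonneg hs.1, hs.2.1, hpos i]

lemma IsSchedule.throughput_mono (hpos : ∀ i, 0 < ℓ i) (h : IsSchedule ℓ A E σ) :
    Monotone (throughput ℓ E σ) := by
  intro s t hst
  refine Finset.sum_le_sum fun i _ => ?_
  have := hpos i
  have := h.sentBy_mono hpos i hst
  gcongr

lemma throughput_nonneg (hpos : ∀ i, 0 < ℓ i) (t : ℝ) : 0 ≤ throughput ℓ E σ t :=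
  Finset.sum_nonneg fun i _ => mul_nonneg (hpos i).le (Nat.cast_nonneg _)

end PacketScheduling

/-! ### Arithmetic of the block sizes -/

namespace PacketScheduling

variable {k : ℕ} {ℓ : Fin k → ℝ}

/-- If `r` is the length sent since the last error, followed by `p` packets of length `ℓ j` and an
incomplete one, then packets not shorter than `ℓ j` that fit in the elapsed time have at most
`1 / c` times the length sent. -/
def CompetitiveAfter (ℓ : Fin k → ℝ) (c r : ℝ) : Prop :=
  ∀ (j : Fin k) (p : ℕ) (U : Finset (Fin k)) (n : Fin k → ℕ), (∀ i ∈ U, j ≤ i) →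
    ∑ i ∈ U, ℓ i * (n i : ℝ) < r + (p + 1) * ℓ j → c * ∑ i ∈ U, ℓ i * (n i : ℝ) ≤ r + p * ℓ j

lemma natCast_floor_div_mul_le {x y : ℝ} (hx : 0 ≤ x) (hy : 0 < y) : (⌊x / y⌋₊ : ℝ) * y ≤ x := by
  rw [← le_div_iff₀ hy]
  exact Nat.floor_le (div_nonneg hx hy.le)

/-- Replace every packet of length `ℓ i` by `⌊ℓ i / ℓ j⌋₊` packets of length `ℓ j`. This loses at
most the factor `c`, and since `r` is a multiple of `ℓ j`, at most `z + p` such packets fit strictly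
below `(z + p + 1) * ℓ j`. -/
lemma competitiveAfter_of_multiple (hpos : ∀ i, 0 < ℓ i) {c : ℝ}
    (hc : ∀ j i, j ≤ i → c * ℓ i ≤ ⌊ℓ i / ℓ j⌋₊ * ℓ j) {r : ℝ}
    (hr : ∀ j, ∃ z : ℕ, r = z * ℓ j) : CompetitiveAfter ℓ c r := by
  intro j p U n hU hlt
  obtain ⟨z, rfl⟩ := hr j
  set Q : ℕ := ∑ i ∈ U, ⌊ℓ i / ℓ j⌋₊ * n i with hQ
  have hQ' : (Q : ℝ) * ℓ j = ∑ i ∈ U, (⌊ℓ i / ℓ j⌋₊ * ℓ j) * (n i : ℝ) := by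
    rw [hQ]
    push_cast
    rw [Finset.sum_mul]
    exact Finset.sum_congr rfl fun i _ => by ring
  have h1 : (Q : ℝ) * ℓ j ≤ ∑ i ∈ U, ℓ i * (n i : ℝ) := by
    rw [hQ']
    gcongr with i _
    exact natCast_floor_div_mul_le (hpos i).le (hpos j)
  have h2 : Q ≤ z + p := by
    have h3 : (Q : ℝ) * ℓ j < (z + p + 1 : ℝ) * ℓ j := by linarith
    have h4 := lt_of_mul_lt_mul_right h3 (hpos j).le
    have h5 : Q < z + p + 1 := by exact_mod_cast h4
    omega
  have h2' : (Q : ℝ) ≤ z + p := by exact_mod_cast h2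
  calc c * ∑ i ∈ U, ℓ i * (n i : ℝ) = ∑ i ∈ U, (c * ℓ i) * (n i : ℝ) := by
        rw [Finset.mul_sum]
        exact Finset.sum_congr rfl fun i _ => by ring
    _ ≤ Q * ℓ j := by
        rw [hQ']
        exact Finset.sum_le_sum fun i hi =>
          mul_le_mul_of_nonneg_right (hc j i (hU i hi)) (Nat.cast_nonneg _)
    _ ≤ (z + p) * ℓ j := by
        have := hpos j
        gcongr
    _ = _ := by ring

/-- Suitable sizes of the blocks of packets of one length. -/
lemma exists_block_sizes (hk : 0 < k) (hpos : ∀ i, 0 < ℓ i) (hmono : StrictMono ℓ) {c : ℝ}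
    (hc0 : 0 < c) (hc1 : c ≤ 1) (hc : ∀ j i, j ≤ i → c * ℓ i ≤ ⌊ℓ i / ℓ j⌋₊ * ℓ j) :
    ∃ N : Fin k → ℕ, (∀ j, 1 ≤ N j) ∧
      ∀ r ∈ AddSubmonoid.closure (Set.range fun i => (N i : ℝ) * ℓ i), CompetitiveAfter ℓ c r := by
  obtain ⟨m, hle⟩ : ∃ m : Fin k, ∀ i, i ≤ m :=
    ⟨⟨k - 1, by omega⟩, fun i => Fin.le_def.2 (Nat.le_sub_one_of_lt i.2)⟩
  rcases hc1.lt_or_eq with hlt | rfl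
  -- For `c < 1` the blocks are so long that after one of them the gain `(1 - c) * r` pays for an
  -- incomplete packet of any length. The `+ 1` only makes the sizes visibly positive.
  · refine ⟨fun i => ⌈ℓ m / ((1 - c) * ℓ i)⌉₊ + 1, fun j => Nat.le_add_left 1 _, fun r hr => ?_⟩
    have h1c : 0 < 1 - c := by linarith
    have key : r = 0 ∨ ℓ m ≤ (1 - c) * r := by
      induction hr using AddSubmonoid.closure_induction with
      | mem x hx =>
        obtain ⟨i, rfl⟩ := hx
        right
        have h1 := Nat.le_ceil (ℓ m / ((1 - c) * ℓ i))
        have h2 : 0 < (1 - c) * ℓ i := mul_pos h1c (hpos i)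
        rw [div_le_iff₀ h2] at h1
        push_cast
        linarith
      | zero => exact Or.inl rfl
      | add x y _ _ hx hy =>
        rcases hx with rfl | hx
        · simpa using hy
        · rcases hy with rfl | hy
          · right
            simpa using hx
          · right
            linarith [hpos m]
    rcases key with rfl | hbig
    · exact competitiveAfter_of_multiple hpos hc fun j => ⟨0, by simp⟩
    · intro j p U n _ hsum
      have h1 : ℓ j ≤ ℓ m := hmono.monotone (hle j)
      have h2 : 0 ≤ (1 - c) * (p * ℓ j) := mul_nonneg h1c.le (mul_nonneg p.cast_nonneg (hpos j).le)
      have h3 : c * ℓ j ≤ ℓ j := mul_le_of_le_one_left (hpos j).le hc1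
      nlinarith [mul_le_mul_of_nonneg_left hsum.le hc0.le]
  -- For `c = 1` the hypothesis forces every length to divide the largest one, `ℓ m`; all blocks
  -- then get the same total length `ℓ m`.
  · have hmul : ∀ j, (⌊ℓ m / ℓ j⌋₊ : ℝ) * ℓ j = ℓ m := fun j =>
      le_antisymm (natCast_floor_div_mul_le (hpos m).le (hpos j)) (by simpa using hc j m (hle j))
    refine ⟨fun i => ⌊ℓ m / ℓ i⌋₊, fun j => ?_, fun r hr => ?_⟩
    · rw [Nat.one_le_floor_iff, one_le_div (hpos j)]
      exact hmono.monotone (hle j)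
    · refine competitiveAfter_of_multiple hpos hc fun j => ?_
      simp only [hmul] at hr
      obtain ⟨z, hz⟩ : ∃ z : ℕ, r = z * ℓ m := by
        induction hr using AddSubmonoid.closure_induction with
        | mem x hx =>
          obtain ⟨i, rfl⟩ := hx
          exact ⟨1, by simp⟩
        | zero => exact ⟨0, by simp⟩
        | add x y _ _ hx hy =>
          obtain ⟨z, rfl⟩ := hx
          obtain ⟨w, rfl⟩ := hy
          exact ⟨z + w, by push_cast; ring⟩
      exact ⟨z * ⌊ℓ m / ℓ j⌋₊, by rw [hz]; push_cast; rw [mul_assoc, hmul]⟩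

end PacketScheduling

/-! ### The block algorithm -/

noncomputable section

namespace PacketScheduling

/-- The end of a block of transmissions of total length `L` started at time `d`: the first error
after `d`, but no later than `d + L`. -/
def blockEnd (E : ErrorPattern) (d L : ℝ) : ℝ :=
  sInf (insert (d + L) {e | e ∈ E.times ∧ d < e})

/-- The infimum is attained because only finitely many errors occur up to `d + L`. -/
lemma isLeast_blockEnd (E : ErrorPattern) (d L : ℝ) :
    IsLeast (insert (d + L) {e | e ∈ E.times ∧ d < e}) (blockEnd E d L) := by
  suffices h : ∃ m, IsLeast (insert (d + L) {e | e ∈ E.times ∧ d < e}) m by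
    obtain ⟨m, hm⟩ := h
    rwa [blockEnd, hm.csInf_eq]
  have hfin : (insert (d + L) {e | e ≤ d + L ∧ e ∈ E.times ∧ d < e}).Finite :=
    ((E.finite_le (d + L)).subset fun e he => ⟨he.1, he.2.1⟩).insert _
  obtain ⟨m, hm, hmin⟩ := Set.exists_min_image _ id hfin ⟨d + L, Or.inl rfl⟩
  refine ⟨m, ?_, ?_⟩
  · rcases hm with h | h
    · exact Or.inl h
    · exact Or.inr h.2
  · rintro e (rfl | he)
    · exact hmin _ (Or.inl rfl)
    · by_cases hle : e ≤ d + L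
      · exact hmin e (Or.inr ⟨hle, he⟩)
      · exact (hmin _ (Or.inl rfl)).trans (not_le.1 hle).le

lemma blockEnd_le (E : ErrorPattern) (d L : ℝ) : blockEnd E d L ≤ d + L :=
  (isLeast_blockEnd E d L).2 (Or.inl rfl)

lemma lt_blockEnd (E : ErrorPattern) (d : ℝ) {L : ℝ} (hL : 0 < L) : d < blockEnd E d L := by
  rcases (isLeast_blockEnd E d L).1 with h | h
  · rw [h]
    linarith
  · exact h.2

lemma blockEnd_eq_or_mem (E : ErrorPattern) (d L : ℝ) :
    blockEnd E d L = d + L ∨ blockEnd E d L ∈ E.times := by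
  rcases (isLeast_blockEnd E d L).1 with h | h
  · exact Or.inl h
  · exact Or.inr h.1

lemma blockEnd_le_of_mem {E : ErrorPattern} {d e : ℝ} (L : ℝ) (he : e ∈ E.times) (hd : d < e) :
    blockEnd E d L ≤ e :=
  (isLeast_blockEnd E d L).2 (Or.inr ⟨he, hd⟩)

lemma blockEnd_congr {E E' : ErrorPattern} {t : ℝ} (h : ∀ s ≤ t, s ∈ E.times ↔ s ∈ E'.times)
    {d L : ℝ} (ht : blockEnd E d L ≤ t) : blockEnd E d L = blockEnd E' d L := by
  obtain ⟨h1, h2⟩ := isLeast_blockEnd E d L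
  refine (IsLeast.csInf_eq (a := blockEnd E d L) ⟨?_, ?_⟩).symm
  · rcases h1 with h1 | h1
    · exact Or.inl h1
    · exact Or.inr ⟨(h _ ht).1 h1.1, h1.2⟩
  · rintro e (rfl | he)
    · exact h2 (Or.inl rfl)
    · by_cases hle : e ≤ t
      · exact h2 (Or.inr ⟨(h _ hle).2 he.1, he.2⟩)
      · exact ht.trans (not_le.1 hle).le

variable {k : ℕ} (ℓ : Fin k → ℝ) (w : ℝ) (N : Fin k → ℕ) (A : ArrivalPattern k) (E : ErrorPattern)

/-- The smallest `j` such that at least `N j` packets are waiting at time `d`, where `a` counts the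
packets sent so far. -/
def choice (d : ℝ) (a : Fin k → ℕ) : Option (Fin k) :=
  if h : (Finset.univ.filter fun j => a j + N j ≤ A.arrivedBy j d).Nonempty then
    some (Finset.min' _ h)
  else none

lemma add_le_arrivedBy_of_choice {d : ℝ} {a : Fin k → ℕ} {j : Fin k}
    (h : choice N A d a = some j) : a j + N j ≤ A.arrivedBy j d := by
  unfold choice at h
  split_ifs at h with h1
  rw [Option.some.injEq] at h
  have := Finset.min'_mem _ h1
  rw [h] at this
  exact (Finset.mem_filter.1 this).2

lemma le_of_choice {d : ℝ} {a : Fin k → ℕ} {j i : Fin k} (h : choice N A d a = some j)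
    (hi : a i + N i ≤ A.arrivedBy i d) : j ≤ i := by
  unfold choice at h
  split_ifs at h with h1
  rw [Option.some.injEq] at h
  rw [← h]
  exact Finset.min'_le _ i (Finset.mem_filter.2 ⟨Finset.mem_univ i, hi⟩)

lemma choice_congr {A A' : ArrivalPattern k} {d : ℝ}
    (h : ∀ i, ∀ s ≤ d, A.count i s = A'.count i s) (a : Fin k → ℕ) :
    choice N A d a = choice N A' d a := by
  unfold choice
  simp only [fun j => ArrivalPattern.arrivedBy_congr j (h j)]

lemma lt_of_choice_eq_none {d : ℝ} {a : Fin k → ℕ} (h : choice N A d a = none) (i : Fin k) :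
    A.arrivedBy i d < a i + N i := by
  unfold choice at h
  split_ifs at h with h1
  by_contra! hi
  exact h1 ⟨i, Finset.mem_filter.2 ⟨Finset.mem_univ _, hi⟩⟩

/-- The length of a block. If nothing is chosen, the sender stays idle for time `w`. -/
def blockLength : Option (Fin k) → ℝ
  | none => w
  | some j => N j * ℓ j

/-- The starting time of the `n`-th block and the numbers of packets sent before. In each block, the
smallest sufficiently numerous packets are sent. -/
def blockState : ℕ → ℝ × (Fin k → ℕ)
  | 0 => (0, 0)
  | n + 1 =>
    let S := blockState n
    let o := choice N A S.1 S.2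
    let d := blockEnd E S.1 (blockLength ℓ w N o)
    (d, fun i => S.2 i + if o = some i then ⌊(d - S.1) / ℓ i⌋₊ else 0)

/-- The starting time of the `n`-th block. -/
def blockStart (n : ℕ) : ℝ := (blockState ℓ w N A E n).1

/-- The number of packets of each length sent before the `n`-th block. -/
def blockCount (n : ℕ) : Fin k → ℕ := (blockState ℓ w N A E n).2

/-- The length of the packets in the `n`-th block. -/
def blockChoice (n : ℕ) : Option (Fin k) :=
  choice N A (blockStart ℓ w N A E n) (blockCount ℓ w N A E n)

lemma blockStart_zero : blockStart ℓ w N A E 0 = 0 := rfl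

lemma blockCount_zero (i : Fin k) : blockCount ℓ w N A E 0 i = 0 := rfl

lemma blockStart_succ (n : ℕ) : blockStart ℓ w N A E (n + 1) =
    blockEnd E (blockStart ℓ w N A E n) (blockLength ℓ w N (blockChoice ℓ w N A E n)) := rfl

lemma blockCount_succ (n : ℕ) (i : Fin k) : blockCount ℓ w N A E (n + 1) i =
    blockCount ℓ w N A E n i + if blockChoice ℓ w N A E n = some i then
      ⌊(blockStart ℓ w N A E (n + 1) - blockStart ℓ w N A E n) / ℓ i⌋₊ else 0 := rfl

/-- A packet of length `j` is started at time `t` in the `n`-th block. -/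
def StartsIn (n : ℕ) (t : ℝ) (j : Fin k) : Prop :=
  blockChoice ℓ w N A E n = some j ∧
    (∃ q : ℕ, t = blockStart ℓ w N A E n + q * ℓ j) ∧ t < blockStart ℓ w N A E (n + 1)

open Classical in
/-- The schedule that sends blocks of packets of the smallest sufficiently numerous length. -/
def blockRun : Starts k := fun t =>
  if h : ∃ j n, StartsIn ℓ w N A E n t j then some h.choose else none

section

variable {ℓ w N A E}
variable (hw : 0 < w) (hwℓ : ∀ j, w ≤ ℓ j) (hN : ∀ j, 1 ≤ N j)
include hw hwℓ hN

lemma le_blockLength (o : Option (Fin k)) : w ≤ blockLength ℓ w N o := by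
  cases o with
  | none => exact le_rfl
  | some j =>
    have h1 : (1 : ℝ) ≤ N j := by exact_mod_cast hN j
    calc w ≤ ℓ j := hwℓ j
      _ = 1 * ℓ j := (one_mul _).symm
      _ ≤ N j * ℓ j := mul_le_mul_of_nonneg_right h1 (hw.le.trans (hwℓ j))

lemma strictMono_blockStart : StrictMono (blockStart ℓ w N A E) :=
  strictMono_nat_of_lt_succ fun _ =>
    lt_blockEnd E _ (hw.trans_le (le_blockLength hw hwℓ hN _))

/-- Bounded block starts would converge. From some point on blocks would be shorter than `w`, hence
all cut off by errors, giving infinitely many errors in bounded time. -/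
lemma exists_lt_blockStart (T : ℝ) : ∃ n, T < blockStart ℓ w N A E n := by
  by_contra! hT
  have hmono := strictMono_blockStart (A := A) (E := E) hw hwℓ hN
  have hlim := tendsto_atTop_ciSup hmono.monotone ⟨T, by rintro _ ⟨n, rfl⟩; exact hT n⟩
  have hdiff := ((Filter.tendsto_add_atTop_iff_nat 1).2 hlim).sub hlim
  rw [sub_self] at hdiff
  obtain ⟨n₀, hn₀⟩ := Filter.eventually_atTop.1 (hdiff.eventually (gt_mem_nhds hw))
  have hinj : Function.Injective fun m => blockStart ℓ w N A E (n₀ + m + 1) := by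
    intro a b hab
    have := hmono.injective hab
    omega
  refine Set.infinite_range_of_injective hinj ((E.finite_le T).subset ?_)
  rintro _ ⟨m, rfl⟩
  refine ⟨hT _, ?_⟩
  have h1 := hn₀ (n₀ + m) (by omega)
  rcases blockEnd_eq_or_mem E (blockStart ℓ w N A E (n₀ + m))
    (blockLength ℓ w N (blockChoice ℓ w N A E (n₀ + m))) with h2 | h2
  · have h3 := le_blockLength hw hwℓ hN (blockChoice ℓ w N A E (n₀ + m))
    rw [blockStart_succ, h2] at h1
    linarith
  · exact h2

lemma exists_mem_block {t : ℝ} (ht : 0 ≤ t) :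
    ∃ n, blockStart ℓ w N A E n ≤ t ∧ t < blockStart ℓ w N A E (n + 1) := by
  classical
  have hex := exists_lt_blockStart (A := A) (E := E) hw hwℓ hN t
  have h1 := Nat.find_spec hex
  have h2 : Nat.find hex ≠ 0 := fun h0 => by
    rw [h0, blockStart_zero] at h1
    linarith
  obtain ⟨n, hn⟩ := Nat.exists_eq_succ_of_ne_zero h2
  rw [hn] at h1
  exact ⟨n, not_lt.1 (Nat.find_min hex (m := n) (by omega)), h1⟩

omit hN in
lemma StartsIn.blockStart_le {n : ℕ} {t : ℝ} {j : Fin k} (h : StartsIn ℓ w N A E n t j) :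
    blockStart ℓ w N A E n ≤ t := by
  obtain ⟨_, ⟨q, rfl⟩, _⟩ := h
  have : 0 ≤ (q : ℝ) * ℓ j := mul_nonneg q.cast_nonneg (hw.le.trans (hwℓ j))
  linarith

lemma StartsIn.block_le {m n : ℕ} {s t : ℝ} {i j : Fin k} (hs : StartsIn ℓ w N A E m s i)
    (ht : StartsIn ℓ w N A E n t j) (hst : s ≤ t) : m ≤ n := by
  have h1 := hs.blockStart_le hw hwℓ
  have h2 := (strictMono_blockStart (A := A) (E := E) hw hwℓ hN).lt_iff_lt.1
    ((h1.trans hst).trans_lt ht.2.2)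
  omega

/-- Blocks are disjoint in time and each has a single packet length, so the choice made in
`blockRun` is the only one possible. -/
lemma blockRun_eq_some_iff {t : ℝ} {j : Fin k} :
    blockRun ℓ w N A E t = some j ↔ ∃ n, StartsIn ℓ w N A E n t j := by
  unfold blockRun
  constructor
  · intro h
    split_ifs at h with h1
    rw [Option.some.injEq] at h
    rw [← h]
    exact h1.choose_spec
  · rintro ⟨n, hn⟩
    have h1 : ∃ j n, StartsIn ℓ w N A E n t j := ⟨j, n, hn⟩
    rw [dif_pos h1, Option.some.injEq]
    obtain ⟨m, hm⟩ := h1.choose_spec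
    have h2 := le_antisymm (hm.block_le hw hwℓ hN hn le_rfl) (hn.block_le hw hwℓ hN hm le_rfl)
    subst h2
    simpa [hm.1] using hn.1

omit hN in
/-- A packet is completed within its block unless it is broken by the error that ends the block. -/
lemma StartsIn.add_le {n : ℕ} {s : ℝ} {j : Fin k} (h : StartsIn ℓ w N A E n s j) :
    s + ℓ j ≤ blockStart ℓ w N A E (n + 1) ∨ blockStart ℓ w N A E (n + 1) ∈ E.times := by
  obtain ⟨h1, ⟨q, rfl⟩, h3⟩ := h
  have hj : 0 < ℓ j := hw.trans_le (hwℓ j)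
  rcases blockEnd_eq_or_mem E (blockStart ℓ w N A E n)
    (blockLength ℓ w N (blockChoice ℓ w N A E n)) with h2 | h2
  · left
    rw [← blockStart_succ, h1] at h2
    simp only [blockLength] at h2
    rw [h2] at h3 ⊢
    have h4 : (q : ℝ) < N j := by
      refine lt_of_mul_lt_mul_right ?_ hj.le
      linarith
    have h5 : (q : ℝ) + 1 ≤ N j := by exact_mod_cast h4
    nlinarith [mul_le_mul_of_nonneg_right h5 hj.le]
  · exact Or.inr h2

/-- Packets of earlier blocks are complete by the start of the `n`-th block or broken, and no error
lies strictly inside a block. -/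
lemma completed_blockRun (i : Fin k) (n : ℕ) {t : ℝ} (h1 : blockStart ℓ w N A E n ≤ t)
    (h2 : t ≤ blockStart ℓ w N A E (n + 1)) :
    completed ℓ E (blockRun ℓ w N A E) i t =
      completed ℓ E (blockRun ℓ w N A E) i (blockStart ℓ w N A E n) ∪
        if blockChoice ℓ w N A E n = some i then
          (fun q : ℕ => blockStart ℓ w N A E n + q * ℓ i) ''
            (Finset.range ⌊(t - blockStart ℓ w N A E n) / ℓ i⌋₊ : Set ℕ)
        else ∅ := by
  have hi : 0 < ℓ i := hw.trans_le (hwℓ i)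
  have hmono := strictMono_blockStart (A := A) (E := E) hw hwℓ hN
  refine Set.Subset.antisymm ?_ (Set.union_subset (completed_mono i h1) ?_)
  · rintro s ⟨hs, hst, hc⟩
    obtain ⟨m, hm⟩ := (blockRun_eq_some_iff hw hwℓ hN).1 hs
    have hmn : m < n + 1 := by
      refine hmono.lt_iff_lt.1 ((hm.blockStart_le hw hwℓ).trans_lt ?_)
      linarith
    rcases (Nat.lt_succ_iff.1 hmn).lt_or_eq with hlt | rfl
    · left
      refine ⟨hs, ?_, hc⟩
      have h3 : blockStart ℓ w N A E (m + 1) ≤ blockStart ℓ w N A E n := hmono.monotone hlt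
      rcases hm.add_le hw hwℓ with h4 | h4
      · exact h4.trans h3
      · by_contra! h5
        exact hc _ h4 ⟨hm.2.2, by linarith⟩
    · right
      rw [if_pos hm.1]
      obtain ⟨q, rfl⟩ := hm.2.1
      refine ⟨q, ?_, rfl⟩
      simp only [Finset.coe_range, Set.mem_Iio]
      rw [← Nat.succ_le_iff, Nat.le_floor_iff (div_nonneg (by linarith) hi.le), le_div_iff₀ hi]
      push_cast
      linarith
  · split_ifs with hch
    swap
    · exact Set.empty_subset _
    rintro _ ⟨q, hq, rfl⟩
    simp only [Finset.coe_range, Set.mem_Iio] at hq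
    rw [← Nat.succ_le_iff, Nat.le_floor_iff (div_nonneg (by linarith) hi.le),
      le_div_iff₀ hi] at hq
    push_cast at hq
    have hq0 : 0 ≤ (q : ℝ) * ℓ i := by positivity
    refine ⟨(blockRun_eq_some_iff hw hwℓ hN).2 ⟨n, hch, ⟨q, rfl⟩, by linarith⟩, by linarith, ?_⟩
    rintro e he ⟨he1, he2⟩
    have := blockEnd_le_of_mem (d := blockStart ℓ w N A E n)
      (blockLength ℓ w N (blockChoice ℓ w N A E n)) he (by linarith)
    rw [← blockStart_succ] at this
    linarith

/-- `IsSchedule.finite_completed` is not available yet: this finiteness is used to prove that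
`blockRun` is a schedule. -/
lemma finite_completed_blockRun (i : Fin k) (n : ℕ) :
    (completed ℓ E (blockRun ℓ w N A E) i (blockStart ℓ w N A E n)).Finite := by
  induction n with
  | zero =>
    refine Set.Finite.subset Set.finite_empty fun s hs => ?_
    obtain ⟨m, hm⟩ := (blockRun_eq_some_iff hw hwℓ hN).1 hs.1
    have h1 := hm.blockStart_le hw hwℓ
    have h2 := (strictMono_blockStart (A := A) (E := E) hw hwℓ hN).monotone (Nat.zero_le m)
    have := hs.2.1
    have := hwℓ i
    exfalso
    linarith
  | succ n ih =>
    rw [completed_blockRun hw hwℓ hN i n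
      ((strictMono_blockStart (A := A) (E := E) hw hwℓ hN).monotone n.le_succ) le_rfl]
    refine ih.union ?_
    split_ifs
    · exact (Finset.finite_toSet _).image _
    · exact Set.finite_empty

lemma sentBy_blockRun_add (i : Fin k) (n : ℕ) {t : ℝ} (h1 : blockStart ℓ w N A E n ≤ t)
    (h2 : t ≤ blockStart ℓ w N A E (n + 1)) :
    sentBy ℓ E (blockRun ℓ w N A E) i t =
      sentBy ℓ E (blockRun ℓ w N A E) i (blockStart ℓ w N A E n) +
        if blockChoice ℓ w N A E n = some i then ⌊(t - blockStart ℓ w N A E n) / ℓ i⌋₊ else 0 := by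
  have hi : 0 < ℓ i := hw.trans_le (hwℓ i)
  rw [sentBy_eq_ncard, completed_blockRun hw hwℓ hN i n h1 h2]
  split_ifs with hch
  swap
  · simp [sentBy_eq_ncard]
  rw [Set.ncard_union_eq ?_ (finite_completed_blockRun hw hwℓ hN i n)
    ((Finset.finite_toSet _).image _), Set.ncard_image_of_injective, Set.ncard_coe_finset,
    Finset.card_range, sentBy_eq_ncard]
  · intro a b hab
    simpa [hi.ne'] using hab
  · refine Set.disjoint_left.2 ?_
    rintro _ hs ⟨q, _, rfl⟩
    have hq0 : 0 ≤ (q : ℝ) * ℓ i := by positivity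
    linarith [hs.2.1]

lemma sentBy_blockRun_blockStart (i : Fin k) (n : ℕ) :
    sentBy ℓ E (blockRun ℓ w N A E) i (blockStart ℓ w N A E n) = blockCount ℓ w N A E n i := by
  induction n with
  | zero =>
    rw [blockCount_zero, sentBy_eq_ncard,
      Set.ncard_eq_zero (finite_completed_blockRun hw hwℓ hN i 0), Set.eq_empty_iff_forall_notMem]
    intro s hs
    obtain ⟨m, hm⟩ := (blockRun_eq_some_iff hw hwℓ hN).1 hs.1
    have h1 := hm.blockStart_le hw hwℓ
    have h2 := (strictMono_blockStart (A := A) (E := E) hw hwℓ hN).monotone (Nat.zero_le m)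
    have := hs.2.1
    have := hwℓ i
    linarith
  | succ n ih =>
    rw [sentBy_blockRun_add hw hwℓ hN i n
      ((strictMono_blockStart (A := A) (E := E) hw hwℓ hN).monotone n.le_succ) le_rfl, ih,
      blockCount_succ]

lemma sentBy_blockRun (i : Fin k) (n : ℕ) {t : ℝ} (h1 : blockStart ℓ w N A E n ≤ t)
    (h2 : t ≤ blockStart ℓ w N A E (n + 1)) :
    sentBy ℓ E (blockRun ℓ w N A E) i t = blockCount ℓ w N A E n i +
      if blockChoice ℓ w N A E n = some i then ⌊(t - blockStart ℓ w N A E n) / ℓ i⌋₊ else 0 := by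
  rw [sentBy_blockRun_add hw hwℓ hN i n h1 h2, sentBy_blockRun_blockStart hw hwℓ hN]

lemma isSchedule_blockRun : IsSchedule ℓ A E (blockRun ℓ w N A E) where
  available := by
    intro t j ht
    obtain ⟨n, hn⟩ := (blockRun_eq_some_iff hw hwℓ hN).1 ht
    have hj : 0 < ℓ j := hw.trans_le (hwℓ j)
    have h0 := hn.blockStart_le hw hwℓ
    rw [sentBy_blockRun hw hwℓ hN j n h0 hn.2.2.le, if_pos hn.1]
    have h1 := add_le_arrivedBy_of_choice N A hn.1
    have h2 := A.arrivedBy_mono j h0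
    obtain ⟨hch, ⟨q, rfl⟩, hlt⟩ := hn
    have h3 := blockEnd_le E (blockStart ℓ w N A E n)
      (blockLength ℓ w N (blockChoice ℓ w N A E n))
    rw [← blockStart_succ, hch] at h3
    simp only [blockLength] at h3
    have h4 : (q : ℝ) < N j := by
      refine lt_of_mul_lt_mul_right ?_ hj.le
      linarith
    have h5 : q < N j := by exact_mod_cast h4
    rw [add_sub_cancel_left, mul_div_cancel_right₀ _ hj.ne', Nat.floor_natCast]
    omega
  sequential := by
    intro s t i hst hs ht
    obtain ⟨j, hj⟩ := Option.ne_none_iff_exists'.1 ht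
    obtain ⟨m, hm⟩ := (blockRun_eq_some_iff hw hwℓ hN).1 hs
    obtain ⟨n, hn⟩ := (blockRun_eq_some_iff hw hwℓ hN).1 hj
    have hi : 0 < ℓ i := hw.trans_le (hwℓ i)
    rcases (hm.block_le hw hwℓ hN hn hst.le).lt_or_eq with hlt | rfl
    · have h1 : blockStart ℓ w N A E (m + 1) ≤ blockStart ℓ w N A E n :=
        (strictMono_blockStart (A := A) (E := E) hw hwℓ hN).monotone hlt
      have h2 := hn.blockStart_le hw hwℓ
      rcases hm.add_le hw hwℓ with h3 | h3
      · exact Or.inl (by linarith)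
      · exact Or.inr ⟨_, h3, hm.2.2, h1.trans h2⟩
    · left
      have hij : i = j := by simpa [hm.1] using hn.1
      subst hij
      obtain ⟨q, rfl⟩ := hm.2.1
      obtain ⟨q', rfl⟩ := hn.2.1
      have h1 : (q : ℝ) < q' := by
        refine lt_of_mul_lt_mul_right ?_ hi.le
        linarith
      have h2 : (q : ℝ) + 1 ≤ q' := by exact_mod_cast h1
      nlinarith [mul_le_mul_of_nonneg_right h2 hi.le]

/-! ### Causality of the block algorithm -/

variable {A' : ArrivalPattern k} {E' : ErrorPattern}

lemma blockState_congr {t : ℝ} (hA : ∀ i, ∀ s ≤ t, A.count i s = A'.count i s)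
    (hE : ∀ s ≤ t, s ∈ E.times ↔ s ∈ E'.times) (n : ℕ) (hn : blockStart ℓ w N A E n ≤ t) :
    blockState ℓ w N A E n = blockState ℓ w N A' E' n := by
  induction n with
  | zero => rfl
  | succ n ih =>
    have h1 : blockStart ℓ w N A E n ≤ t :=
      ((strictMono_blockStart (A := A) (E := E) hw hwℓ hN).monotone n.le_succ).trans hn
    have h2 := ih h1
    have h3 : choice N A (blockState ℓ w N A E n).1 (blockState ℓ w N A E n).2 =
        choice N A' (blockState ℓ w N A E n).1 (blockState ℓ w N A E n).2 :=
      choice_congr N (fun i s hs => hA i s (hs.trans h1)) _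
    have h4 := blockEnd_congr hE hn
    simp only [blockState]
    rw [← h2, ← h3, ← h4]

lemma StartsIn.congr {t : ℝ} (hA : ∀ i, ∀ s ≤ t, A.count i s = A'.count i s)
    (hE : ∀ s ≤ t, s ∈ E.times ↔ s ∈ E'.times) {n : ℕ} {j : Fin k}
    (h : StartsIn ℓ w N A E n t j) : StartsIn ℓ w N A' E' n t j := by
  have h0 := h.blockStart_le hw hwℓ
  have h1 := blockState_congr hw hwℓ hN hA hE n h0
  have hd : blockStart ℓ w N A E n = blockStart ℓ w N A' E' n := congrArg Prod.fst h1
  have ha : blockCount ℓ w N A E n = blockCount ℓ w N A' E' n := congrArg Prod.snd h1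
  have hch : blockChoice ℓ w N A E n = blockChoice ℓ w N A' E' n := by
    unfold blockChoice
    rw [← hd, ← ha]
    exact choice_congr N (fun i s hs => hA i s (hs.trans h0)) _
  refine ⟨hch ▸ h.1, hd ▸ h.2.1, ?_⟩
  -- If the block ended by time `t` under the primed patterns, the symmetric congruence would end it
  -- at the same time under the original ones.
  by_contra! hle
  have h2 := blockState_congr hw hwℓ hN (fun i s hs => (hA i s hs).symm)
    (fun s hs => (hE s hs).symm) (n + 1) hle
  have h3 : blockStart ℓ w N A' E' (n + 1) = blockStart ℓ w N A E (n + 1) := congrArg Prod.fst h2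
  linarith [h.2.2]

lemma blockRun_congr {t : ℝ} (hA : ∀ i, ∀ s ≤ t, A.count i s = A'.count i s)
    (hE : ∀ s ≤ t, s ∈ E.times ↔ s ∈ E'.times) :
    blockRun ℓ w N A E t = blockRun ℓ w N A' E' t := by
  refine Option.ext fun j => ?_
  rw [blockRun_eq_some_iff hw hwℓ hN, blockRun_eq_some_iff hw hwℓ hN]
  exact ⟨fun ⟨n, hn⟩ => ⟨n, hn.congr hw hwℓ hN hA hE⟩,
    fun ⟨n, hn⟩ => ⟨n, hn.congr hw hwℓ hN (fun i s hs => (hA i s hs).symm)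
      fun s hs => (hE s hs).symm⟩⟩

end

/-- The online algorithm that sends blocks of packets of the smallest sufficiently numerous
length. -/
def blockAlgorithm (hw : 0 < w) (hwℓ : ∀ j, w ≤ ℓ j) (hN : ∀ j, 1 ≤ N j) : OnlineAlgorithm ℓ where
  run A E := blockRun ℓ w N A E
  isSchedule _ _ := isSchedule_blockRun hw hwℓ hN
  causal _ _ _ _ _ hA hE := blockRun_congr hw hwℓ hN hA hE

end PacketScheduling

end

/-! ### Competitive analysis of the block algorithm -/

noncomputable section

namespace PacketScheduling

variable {k : ℕ} {ℓ : Fin k → ℝ} {w : ℝ} {N : Fin k → ℕ} {A : ArrivalPattern k} {E : ErrorPattern}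
  {σ off : Starts k}

/-- The total length of the packets with lengths in `U` successfully transmitted by time `t`. -/
def throughputOn (ℓ : Fin k → ℝ) (E : ErrorPattern) (σ : Starts k) (U : Finset (Fin k)) (t : ℝ) :
    ℝ :=
  ∑ i ∈ U, ℓ i * (sentBy ℓ E σ i t : ℝ)

lemma throughputOn_univ (t : ℝ) :
    throughputOn ℓ E σ Finset.univ t = throughput ℓ E σ t := rfl

lemma throughputOn_nonneg (hpos : ∀ i, 0 < ℓ i) (U : Finset (Fin k)) (t : ℝ) :
    0 ≤ throughputOn ℓ E σ U t :=
  Finset.sum_nonneg fun i _ => mul_nonneg (hpos i).le (Nat.cast_nonneg _)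

lemma IsSchedule.throughputOn_add (hpos : ∀ i, 0 < ℓ i) (h : IsSchedule ℓ A E σ)
    (U : Finset (Fin k)) {x y : ℝ} (hxy : x ≤ y) :
    throughputOn ℓ E σ U y =
      throughputOn ℓ E σ U x + ∑ i ∈ U, ℓ i * (sentIn ℓ E σ i x y : ℝ) := by
  rw [throughputOn, throughputOn, ← Finset.sum_add_distrib]
  refine Finset.sum_congr rfl fun i _ => ?_
  rw [← h.sentBy_add_sentIn hpos i hxy]
  push_cast
  ring

lemma IsSchedule.throughputOn_mono (hpos : ∀ i, 0 < ℓ i) (h : IsSchedule ℓ A E σ)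
    (U : Finset (Fin k)) : Monotone (throughputOn ℓ E σ U) := by
  intro s t hst
  refine Finset.sum_le_sum fun i _ => ?_
  have := hpos i
  have := h.sentBy_mono hpos i hst
  gcongr

lemma IsSchedule.throughputOn_zero (hpos : ∀ i, 0 < ℓ i) (h : IsSchedule ℓ A E σ)
    (U : Finset (Fin k)) : throughputOn ℓ E σ U 0 = 0 :=
  Finset.sum_eq_zero fun i _ => by rw [h.sentBy_nonpos hpos i le_rfl]; simp

variable (hw : 0 < w) (hwℓ : ∀ j, w ≤ ℓ j) (hN : ∀ j, 1 ≤ N j)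
include hw hwℓ hN

lemma throughput_blockRun_of_some {n : ℕ} {j : Fin k} (hj : blockChoice ℓ w N A E n = some j)
    {t : ℝ} (h1 : blockStart ℓ w N A E n ≤ t) (h2 : t ≤ blockStart ℓ w N A E (n + 1)) :
    throughput ℓ E (blockRun ℓ w N A E) t =
      throughput ℓ E (blockRun ℓ w N A E) (blockStart ℓ w N A E n) +
        ⌊(t - blockStart ℓ w N A E n) / ℓ j⌋₊ * ℓ j := by
  classical
  unfold throughput
  rw [← Finset.add_sum_erase _ _ (Finset.mem_univ j),
    ← Finset.add_sum_erase (f := fun i => ℓ i * (sentBy ℓ E _ i (blockStart ℓ w N A E n) : ℝ)) _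
      (Finset.mem_univ j),
    sentBy_blockRun_add hw hwℓ hN j n h1 h2, if_pos hj,
    Finset.sum_congr rfl (g := fun i => ℓ i *
      (sentBy ℓ E (blockRun ℓ w N A E) i (blockStart ℓ w N A E n) : ℝ))]
  · push_cast
    ring
  · intro i hi
    rw [sentBy_blockRun_add hw hwℓ hN i n h1 h2, if_neg, add_zero]
    rw [hj, Option.some.injEq]
    exact (Finset.ne_of_mem_erase hi).symm

/-- Apart from idle times, a block is filled with successful transmissions up to a bounded time. -/
lemma sub_le_throughput_blockRun {M : ℝ} (hM : ∀ i, ℓ i ≤ M) {n : ℕ} {t : ℝ}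
    (h1 : blockStart ℓ w N A E n ≤ t) (h2 : t ≤ blockStart ℓ w N A E (n + 1)) :
    t - blockStart ℓ w N A E n ≤ throughput ℓ E (blockRun ℓ w N A E) t -
      throughput ℓ E (blockRun ℓ w N A E) (blockStart ℓ w N A E n) +
        if blockChoice ℓ w N A E n = none then w else M := by
  have hpos : ∀ i, 0 < ℓ i := fun i => hw.trans_le (hwℓ i)
  cases hch : blockChoice ℓ w N A E n with
  | none =>
    have h3 := (isSchedule_blockRun (A := A) (E := E) hw hwℓ hN).throughput_mono hpos h1
    have h4 := blockEnd_le E (blockStart ℓ w N A E n)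
      (blockLength ℓ w N (blockChoice ℓ w N A E n))
    rw [← blockStart_succ, hch] at h4
    simp only [blockLength] at h4
    simp only [if_true]
    linarith
  | some j =>
    rw [throughput_blockRun_of_some hw hwℓ hN hch h1 h2]
    have h3 := Nat.lt_floor_add_one ((t - blockStart ℓ w N A E n) / ℓ j)
    rw [div_lt_iff₀ (hpos j)] at h3
    simp only [reduceCtorEq, if_false]
    linarith [hM j]

lemma throughput_blockRun_succ {n : ℕ} {j : Fin k} (hj : blockChoice ℓ w N A E n = some j)
    (h : blockStart ℓ w N A E (n + 1) ∉ E.times) :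
    blockStart ℓ w N A E (n + 1) = blockStart ℓ w N A E n + N j * ℓ j ∧
    throughput ℓ E (blockRun ℓ w N A E) (blockStart ℓ w N A E (n + 1)) =
      throughput ℓ E (blockRun ℓ w N A E) (blockStart ℓ w N A E n) + N j * ℓ j := by
  have h1 : blockStart ℓ w N A E (n + 1) = blockStart ℓ w N A E n + N j * ℓ j := by
    have := (blockEnd_eq_or_mem E (blockStart ℓ w N A E n)
      (blockLength ℓ w N (blockChoice ℓ w N A E n))).resolve_right h
    rwa [← blockStart_succ, hj] at this
  refine ⟨h1, ?_⟩
  rw [throughput_blockRun_of_some hw hwℓ hN hj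
    ((strictMono_blockStart (A := A) (E := E) hw hwℓ hN).monotone n.le_succ) le_rfl, h1,
    add_sub_cancel_left, mul_div_cancel_right₀ _ (hw.trans_le (hwℓ j)).ne', Nat.floor_natCast]

variable {c K M : ℝ} (hc0 : 0 < c) (hc1 : c ≤ 1)
  (hG : ∀ r ∈ AddSubmonoid.closure (Set.range fun i => (N i : ℝ) * ℓ i), CompetitiveAfter ℓ c r)
  (hM : ∀ i, ℓ i ≤ M) (hM0 : 0 ≤ M) (hK : ∀ i, ℓ i * N i ≤ K)
include hc0 hc1 hM hM0

/-- Since `x` the offline schedule gains at most `t - x + M` and the algorithm loses at most `w + M`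
of the time; as `c ≤ 1`, the slack `w + 2 * M` at `x` covers both. -/
lemma blockRun_competitive_step_of_bounded (hoff : IsSchedule ℓ A E off) (U : Finset (Fin k))
    {B x t : ℝ} (hxt : x ≤ t)
    (hx : c * throughputOn ℓ E off U x ≤ throughput ℓ E (blockRun ℓ w N A E) x +
      c * throughputOn ℓ E (blockRun ℓ w N A E) U x + B - (w + 2 * M))
    (ht : t - x ≤ throughput ℓ E (blockRun ℓ w N A E) t -
      throughput ℓ E (blockRun ℓ w N A E) x + (w + M)) :
    c * throughputOn ℓ E off U t ≤ throughput ℓ E (blockRun ℓ w N A E) t +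
      c * throughputOn ℓ E (blockRun ℓ w N A E) U t + B := by
  have hpos : ∀ i, 0 < ℓ i := fun i => hw.trans_le (hwℓ i)
  have hrun := isSchedule_blockRun (A := A) (E := E) hw hwℓ hN
  have h1 := hoff.sum_sentIn_le_add hpos U hM0 hM hxt
  have h2 := mul_le_mul_of_nonneg_left (hrun.throughputOn_mono hpos U hxt) hc0.le
  have h3 := hrun.throughput_mono hpos hxt
  have h4 : c * ∑ i ∈ U, ℓ i * (sentIn ℓ E off i x t : ℝ) ≤
      1 * (throughput ℓ E (blockRun ℓ w N A E) t -
        throughput ℓ E (blockRun ℓ w N A E) x + (w + 2 * M)) := by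
    refine mul_le_mul hc1 (by linarith) ?_ zero_le_one
    exact Finset.sum_nonneg fun i _ => mul_nonneg (hpos i).le (Nat.cast_nonneg _)
  rw [hoff.throughputOn_add hpos U hxt, mul_add]
  linarith

include hK

omit hM hM0 in
-- If fewer than `N i` packets are waiting, no schedule can be more than `N i` packets of length `i`
-- ahead. The term `c * ALG_U` absorbs the packets already sent, and `K` absorbs the rest.
lemma blockRun_competitive_of_covered (hoff : IsSchedule ℓ A E off) {U : Finset (Fin k)} {i : Fin k}
    (hi : i ∈ U) {B : ℝ} {n : ℕ}
    (hU : c * throughputOn ℓ E off (U.erase i) (blockStart ℓ w N A E n) ≤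
      throughput ℓ E (blockRun ℓ w N A E) (blockStart ℓ w N A E n) +
      c * throughputOn ℓ E (blockRun ℓ w N A E) (U.erase i) (blockStart ℓ w N A E n) + B)
    (hcov : A.arrivedBy i (blockStart ℓ w N A E n) < blockCount ℓ w N A E n i + N i) :
    c * throughputOn ℓ E off U (blockStart ℓ w N A E n) ≤
      throughput ℓ E (blockRun ℓ w N A E) (blockStart ℓ w N A E n) +
      c * throughputOn ℓ E (blockRun ℓ w N A E) U (blockStart ℓ w N A E n) + B + K := by
  have hpos : ∀ i, 0 < ℓ i := fun i => hw.trans_le (hwℓ i)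
  have h1 := hoff.sentBy_le_arrivedBy hpos i (blockStart ℓ w N A E n)
  rw [← sentBy_blockRun_blockStart hw hwℓ hN] at hcov
  have h2 : (sentBy ℓ E off i (blockStart ℓ w N A E n) : ℝ) ≤
      sentBy ℓ E (blockRun ℓ w N A E) i (blockStart ℓ w N A E n) + N i := by
    exact_mod_cast (h1.trans hcov.le)
  have h3 : c * (ℓ i * (sentBy ℓ E off i (blockStart ℓ w N A E n) : ℝ)) ≤
      c * (ℓ i * (sentBy ℓ E (blockRun ℓ w N A E) i (blockStart ℓ w N A E n) : ℝ)) + K := by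
    have h4 := mul_le_mul_of_nonneg_left h2 (mul_pos hc0 (hpos i)).le
    have h5 : c * (ℓ i * N i) ≤ 1 * (ℓ i * N i) :=
      mul_le_mul_of_nonneg_right hc1 (mul_nonneg (hpos i).le (Nat.cast_nonneg _))
    linarith [hK i]
  unfold throughputOn at hU ⊢
  rw [← Finset.add_sum_erase U _ hi,
    ← Finset.add_sum_erase U (fun i => ℓ i * (sentBy ℓ E (blockRun ℓ w N A E) i _ : ℝ)) hi,
    mul_add, mul_add]
  linarith

include hG

/-- The invariant of the analysis: up to a constant, `c` times the length that an offline schedule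
sends in packets from `U` is at most what the block algorithm sends plus `c` times what it sends in
packets from `U`. -/
lemma blockRun_competitive (hoff : IsSchedule ℓ A E off) (m : ℕ) :
    ∀ U : Finset (Fin k), U.card = m → ∀ t, 0 ≤ t →
    c * throughputOn ℓ E off U t ≤ throughput ℓ E (blockRun ℓ w N A E) t +
      c * throughputOn ℓ E (blockRun ℓ w N A E) U t + m * (K + (w + 2 * M)) := by
  have hpos : ∀ i, 0 < ℓ i := fun i => hw.trans_le (hwℓ i)
  have hrun := isSchedule_blockRun (A := A) (E := E) hw hwℓ hN
  have hmono := strictMono_blockStart (A := A) (E := E) hw hwℓ hN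
  have hd0 : ∀ n, 0 ≤ blockStart ℓ w N A E n := fun n => hmono.monotone n.zero_le
  induction m with
  | zero =>
    intro U hU t _
    rw [Finset.card_eq_zero.1 hU]
    simpa [throughputOn] using throughput_nonneg hpos t
  | succ m ih =>
    intro U hU
    set d := blockStart ℓ w N A E with hd
    set X := throughput ℓ E (blockRun ℓ w N A E) with hX
    set Y := throughputOn ℓ E (blockRun ℓ w N A E) U with hY
    set Z := throughputOn ℓ E off U with hZ
    set B : ℝ := (m + 1 : ℕ) * (K + (w + 2 * M)) with hB
    -- a block at whose start some packets from `U` are scarce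
    have hscarce : ∀ n, (∃ i ∈ U, A.arrivedBy i (d n) < blockCount ℓ w N A E n i + N i) →
        c * Z (d n) ≤ X (d n) + c * Y (d n) + B - (w + 2 * M) := by
      rintro n ⟨i, hi, hcov⟩
      -- Passing from `m` to `m + 1` raises the constant by `K + (w + 2 * M)`: `K` pays for the
      -- scarce length, the remainder is left as slack.
      have := blockRun_competitive_of_covered hw hwℓ hN hc0 hc1 hK hoff hi
        (ih (U.erase i) (by rw [Finset.card_erase_of_mem hi, hU]; rfl) (d n) (hd0 n)) hcov
      rw [hB]
      push_cast
      linarith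
    -- `fresh`: since time `0` or an error at `x`, where the invariant holds without slack, only
    -- full blocks, of total length `r`, have been sent.
    let fresh : ℕ → Prop := fun n => ∃ x ≤ d n, (x ≤ 0 ∨ x ∈ E.times) ∧
      c * Z x ≤ X x + c * Y x + B ∧
      ∃ r ∈ AddSubmonoid.closure (Set.range fun i => (N i : ℝ) * ℓ i),
        d n - x = r ∧ X (d n) = X x + r
    -- `late`: the invariant holds with slack at `x`, and at most one idle period has been wasted
    -- since then.
    let late : ℕ → Prop := fun n => ∃ x ≤ d n, c * Z x ≤ X x + c * Y x + B - (w + 2 * M) ∧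
      d n - x ≤ X (d n) - X x + w
    have hchoice : ∀ n, (¬ ∃ i ∈ U, A.arrivedBy i (d n) < blockCount ℓ w N A E n i + N i) →
        ∃ j, blockChoice ℓ w N A E n = some j ∧ ∀ i ∈ U, j ≤ i := by
      intro n hn
      push Not at hn
      cases hch : blockChoice ℓ w N A E n with
      | none =>
        obtain ⟨i, hi⟩ : U.Nonempty := Finset.card_pos.1 (by omega)
        exact absurd (lt_of_choice_eq_none N A hch i) (not_lt.2 (hn i hi))
      | some j => exact ⟨j, rfl, fun i hi => le_of_choice N A hch (hn i hi)⟩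
    have hstep : ∀ n, fresh n ∨ late n →
        (∀ t, d n ≤ t → t ≤ d (n + 1) → c * Z t ≤ X t + c * Y t + B) ∧
        (d (n + 1) ∉ E.times → fresh (n + 1) ∨ late (n + 1)) := by
      intro n hn
      have hle : d n ≤ d (n + 1) := hmono.monotone n.le_succ
      by_cases hsc : ∃ i ∈ U, A.arrivedBy i (d n) < blockCount ℓ w N A E n i + N i
      · have h0 := hscarce n hsc
        refine ⟨fun t h1 h2 => ?_, fun herr => Or.inr ⟨d n, hle, h0, ?_⟩⟩
        · refine blockRun_competitive_step_of_bounded hw hwℓ hN hc0 hc1 hM hM0 hoff U h1 h0 ?_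
          refine (sub_le_throughput_blockRun hw hwℓ hN hM h1 h2).trans ?_
          split_ifs <;> linarith
        · cases hch : blockChoice ℓ w N A E n with
          | none =>
            have := sub_le_throughput_blockRun hw hwℓ hN hM hle le_rfl
            rwa [if_pos hch] at this
          | some j =>
            obtain ⟨h1, h2⟩ := throughput_blockRun_succ hw hwℓ hN hch herr
            linarith
      · obtain ⟨j, hj, hjU⟩ := hchoice n hsc
        rcases hn with ⟨x, hx, hfr, hinv, r, hr, hr1, hr2⟩ | ⟨x, hx, hinv, hx2⟩
        · refine ⟨fun t h1 h2 => ?_, fun herr => Or.inl ⟨x, hx.trans hle, hfr, hinv, ?_⟩⟩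
          -- The offline gain since `x` is at most `t - x`, which is less than `r` plus one more
          -- packet than the current block has completed; `CompetitiveAfter` then applies exactly,
          -- with no additive loss.
          · have h3 := hoff.sum_sentIn_le_of_fresh hpos U (hx.trans h1) hfr
            have h4 := Nat.lt_floor_add_one ((t - d n) / ℓ j)
            rw [div_lt_iff₀ (hpos j)] at h4
            have h5 := hG r hr j ⌊(t - d n) / ℓ j⌋₊ U (fun i => sentIn ℓ E off i x t) hjU
              (by linarith)
            have h6 := throughput_blockRun_of_some hw hwℓ hN hj h1 h2
            have h7 := mul_le_mul_of_nonneg_left (hrun.throughputOn_mono hpos U (hx.trans h1))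
              hc0.le
            have h8 := hoff.throughputOn_add hpos U (hx.trans h1)
            rw [hZ, h8, mul_add]
            linarith
          · obtain ⟨h1, h2⟩ := throughput_blockRun_succ hw hwℓ hN hj herr
            exact ⟨r + N j * ℓ j, add_mem hr (AddSubmonoid.subset_closure ⟨j, rfl⟩),
              by linarith, by linarith⟩
        · refine ⟨fun t h1 h2 => ?_, fun herr => Or.inr ⟨x, hx.trans hle, hinv, ?_⟩⟩
          · refine blockRun_competitive_step_of_bounded hw hwℓ hN hc0 hc1 hM hM0 hoff U
              (hx.trans h1) hinv ?_
            have := sub_le_throughput_blockRun hw hwℓ hN hM h1 h2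
            rw [if_neg (by rw [hj]; simp)] at this
            linarith
          · obtain ⟨h1, h2⟩ := throughput_blockRun_succ hw hwℓ hN hj herr
            linarith
    have hall : ∀ n, fresh n ∨ late n := by
      intro n
      induction n with
      | zero =>
        refine Or.inl ⟨0, le_rfl, Or.inl le_rfl, ?_, 0, zero_mem _, sub_self _, (add_zero _).symm⟩
        rw [hZ, hoff.throughputOn_zero hpos, mul_zero]
        obtain ⟨i, _⟩ : U.Nonempty := Finset.card_pos.1 (by omega)
        have hK0 : 0 ≤ K := (mul_nonneg (hpos i).le (Nat.cast_nonneg _)).trans (hK i)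
        have h1 : 0 ≤ X 0 := throughput_nonneg hpos 0
        have h2 : 0 ≤ Y 0 := throughputOn_nonneg hpos U 0
        have h3 : 0 ≤ B := by positivity
        positivity
      | succ n ihn =>
        obtain ⟨h1, h2⟩ := hstep n ihn
        -- An error resets either state to `fresh`, since the invariant with the same constant `B`
        -- holds throughout the block, its end included.
        by_cases herr : d (n + 1) ∈ E.times
        · exact Or.inl ⟨d (n + 1), le_rfl, Or.inr herr,
            h1 _ (hmono.monotone n.le_succ) le_rfl, 0, zero_mem _, sub_self _, (add_zero _).symm⟩
        · exact h2 herr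
    intro t ht
    obtain ⟨n, h1, h2⟩ := exists_mem_block (A := A) (E := E) hw hwℓ hN ht
    exact (hstep n (hall n)).1 t h1 h2.le

end PacketScheduling

end

/-! ### The adversary -/

noncomputable section

namespace PacketScheduling

/-- The start of the `n`-th phase of the adversary, which is short (of length `x`) if `b n` holds
and long (of length `y`) otherwise. -/
def phaseStart (x y : ℝ) (b : ℕ → Bool) (n : ℕ) : ℝ :=
  ∑ m ∈ Finset.range n, if b m then x else y

section

variable {x y : ℝ} {b b' : ℕ → Bool}

lemma phaseStart_succ (n : ℕ) :
    phaseStart x y b (n + 1) = phaseStart x y b n + if b n then x else y :=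
  Finset.sum_range_succ _ _

lemma phaseStart_congr {n : ℕ} (h : ∀ m < n, b m = b' m) :
    phaseStart x y b n = phaseStart x y b' n :=
  Finset.sum_congr rfl fun m hm => by rw [h m (Finset.mem_range.1 hm)]

lemma strictMono_phaseStart (hx : 0 < x) (hxy : x < y) : StrictMono (phaseStart x y b) := by
  refine strictMono_nat_of_lt_succ fun n => ?_
  rw [phaseStart_succ]
  split_ifs <;> linarith

lemma nat_mul_le_phaseStart (hxy : x < y) (n : ℕ) : n * x ≤ phaseStart x y b n := by
  induction n with
  | zero => simp [phaseStart]
  | succ n ih =>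
    rw [phaseStart_succ]
    push_cast
    split_ifs <;> linarith

lemma phaseStart_nonneg (hx : 0 < x) (hxy : x < y) (n : ℕ) : 0 ≤ phaseStart x y b n :=
  (mul_nonneg n.cast_nonneg hx.le).trans (nat_mul_le_phaseStart hxy n)

lemma finite_phaseStart_le (hx : 0 < x) (hxy : x < y) (T : ℝ) :
    {t | t ≤ T ∧ ∃ n, t = phaseStart x y b n}.Finite := by
  refine ((Set.finite_Iic ⌊T / x⌋₊).image (phaseStart x y b)).subset ?_
  rintro _ ⟨hT, n, rfl⟩
  refine ⟨n, Nat.le_floor ?_, rfl⟩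
  rw [le_div_iff₀ hx]
  exact (nat_mul_le_phaseStart hxy n).trans hT

lemma exists_mem_phase (hx : 0 < x) (hxy : x < y) {s : ℝ} (hs : 0 ≤ s) :
    ∃ n, phaseStart x y b n ≤ s ∧ s < phaseStart x y b (n + 1) := by
  classical
  have hex : ∃ n, s < phaseStart x y b n := by
    obtain ⟨n, hn⟩ := exists_nat_gt (s / x)
    rw [div_lt_iff₀ hx] at hn
    exact ⟨n, hn.trans_le (nat_mul_le_phaseStart hxy n)⟩
  have h1 := Nat.find_spec hex
  have h2 : Nat.find hex ≠ 0 := fun h0 => by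
    rw [h0] at h1
    simp only [phaseStart, Finset.range_zero, Finset.sum_empty] at h1
    linarith
  obtain ⟨n, hn⟩ := Nat.exists_eq_succ_of_ne_zero h2
  rw [hn] at h1
  exact ⟨n, not_lt.1 (Nat.find_min hex (m := n) (by omega)), h1⟩

end

variable {k : ℕ}

/-- At the start of the `n`-th phase of the adversary a packet of length `i'` arrives: a long one
(`i' = i`) in each phase, a short one (`i' = j`) in the first phase and after each short phase. -/
def PhaseArrival (i j : Fin k) (b : ℕ → Bool) (i' : Fin k) (n : ℕ) : Prop :=
  i' = i ∨ i' = j ∧ (n = 0 ∨ b (n - 1) = true)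

open Classical in
/-- The arrivals prescribed by the adversary. -/
def phaseArrivals {x y : ℝ} (hx : 0 < x) (hxy : x < y) (i j : Fin k) (b : ℕ → Bool) :
    ArrivalPattern k where
  count i' t := if ∃ n, t = phaseStart x y b n ∧ PhaseArrival i j b i' n then 1 else 0
  count_of_neg i' t ht := by
    refine if_neg ?_
    rintro ⟨n, rfl, _⟩
    exact absurd (phaseStart_nonneg hx hxy n) (not_le.2 ht)
  finite_le i' T := by
    refine (finite_phaseStart_le (b := b) hx hxy T).subset ?_
    rintro t ⟨ht, hne⟩
    by_contra h
    refine hne (if_neg ?_)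
    rintro ⟨n, rfl, _⟩
    exact h ⟨ht, n, rfl⟩

/-- The errors prescribed by the adversary, at the start of each phase. -/
def phaseErrors {x y : ℝ} (hx : 0 < x) (hxy : x < y) (b : ℕ → Bool) : ErrorPattern where
  times := {t | ∃ n, t = phaseStart x y b n}
  nonneg := by
    rintro _ ⟨n, rfl⟩
    exact phaseStart_nonneg hx hxy n
  finite_le := finite_phaseStart_le hx hxy

section

variable {x y : ℝ} (hx : 0 < x) (hxy : x < y) (i j : Fin k) (b : ℕ → Bool)

open Classical in
lemma arrivedBy_phaseArrivals (i' : Fin k) (n : ℕ) :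
    (phaseArrivals hx hxy i j b).arrivedBy i' (phaseStart x y b n) =
      ∑ m ∈ Finset.range (n + 1), if PhaseArrival i j b i' m then 1 else 0 := by
  have hmono := strictMono_phaseStart (b := b) hx hxy
  have h1 : (phaseArrivals hx hxy i j b).arrivedBy i' (phaseStart x y b n) =
      ∑ s ∈ (Finset.range (n + 1)).image (phaseStart x y b),
        (phaseArrivals hx hxy i j b).count i' s := by
    refine finsum_mem_eq_sum_of_inter_support_eq (s := Set.Iic (phaseStart x y b n)) _ ?_
    ext s
    simp only [Set.mem_inter_iff, Set.mem_Iic, Function.mem_support, Finset.coe_image,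
      Finset.coe_range, Set.mem_image, Set.mem_Iio]
    refine and_congr_left fun hne => ⟨fun hs => ?_, ?_⟩
    · by_contra hcon
      refine hne (if_neg ?_)
      rintro ⟨m, rfl, _⟩
      exact hcon ⟨m, Nat.lt_succ_iff.2 (hmono.le_iff_le.1 hs), rfl⟩
    · rintro ⟨m, hm, rfl⟩
      exact hmono.monotone (Nat.lt_succ_iff.1 hm)
  rw [h1, Finset.sum_image fun _ _ _ _ h => hmono.injective h]
  refine Finset.sum_congr rfl fun m _ => ?_
  refine if_congr ⟨?_, fun h => ⟨m, rfl, h⟩⟩ rfl rfl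
  rintro ⟨m', h, hm'⟩
  rwa [hmono.injective h]

/-- The number of short phases before the `n`-th one. -/
def shortPhases (n : ℕ) : ℕ := ∑ m ∈ Finset.range n, if b m then 1 else 0

/-- The number of long phases before the `n`-th one. -/
def longPhases (n : ℕ) : ℕ := ∑ m ∈ Finset.range n, if b m then 0 else 1

lemma phaseStart_eq (n : ℕ) :
    phaseStart x y b n = shortPhases b n * x + longPhases b n * y := by
  unfold phaseStart shortPhases longPhases
  push_cast
  rw [Finset.sum_mul, Finset.sum_mul, ← Finset.sum_add_distrib]
  refine Finset.sum_congr rfl fun m _ => ?_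
  split_ifs <;> simp

variable {i j}

lemma arrivedBy_phaseArrivals_short (hij : j ≠ i) (n : ℕ) :
    (phaseArrivals hx hxy i j b).arrivedBy j (phaseStart x y b n) = shortPhases b n + 1 := by
  classical
  rw [arrivedBy_phaseArrivals, Finset.sum_range_succ', shortPhases]
  simp [PhaseArrival, hij]

lemma arrivedBy_phaseArrivals_long (n : ℕ) :
    (phaseArrivals hx hxy i j b).arrivedBy i (phaseStart x y b n) = n + 1 := by
  classical
  rw [arrivedBy_phaseArrivals]
  simp [PhaseArrival]

lemma arrivedBy_phaseArrivals_other {i' : Fin k} (h1 : i' ≠ i) (h2 : i' ≠ j) (n : ℕ) :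
    (phaseArrivals hx hxy i j b).arrivedBy i' (phaseStart x y b n) = 0 := by
  classical
  rw [arrivedBy_phaseArrivals]
  simp [PhaseArrival, h1, h2]

variable {b} {b' : ℕ → Bool}

/-- All arrivals and errors up to the start of phase `n`, inclusive, are determined by the earlier
phases. Hence the adversary may let the length of phase `n` depend on what the algorithm starts
there. -/
lemma run_phase_congr {ℓ : Fin k → ℝ} (alg : OnlineAlgorithm ℓ) {n : ℕ}
    (h : ∀ m < n, b m = b' m) :
    alg.run (phaseArrivals hx hxy i j b) (phaseErrors hx hxy b) (phaseStart x y b n) =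
      alg.run (phaseArrivals hx hxy i j b') (phaseErrors hx hxy b') (phaseStart x y b' n) := by
  classical
  have key : ∀ {b b' : ℕ → Bool}, (∀ m < n, b m = b' m) → ∀ {m : ℕ},
      phaseStart x y b m ≤ phaseStart x y b n →
      phaseStart x y b m = phaseStart x y b' m ∧
        ∀ i', PhaseArrival i j b i' m → PhaseArrival i j b' i' m := by
    intro b b' h m hm
    have hmn := (strictMono_phaseStart hx hxy).le_iff_le.1 hm
    refine ⟨phaseStart_congr fun l hl => h l (hl.trans_le hmn), fun i' => ?_⟩
    rintro (h1 | ⟨h1, h2 | h2⟩)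
    · exact Or.inl h1
    · exact Or.inr ⟨h1, Or.inl h2⟩
    · by_cases hm0 : m = 0
      · exact Or.inr ⟨h1, Or.inl hm0⟩
      · exact Or.inr ⟨h1, Or.inr ((h (m - 1) (by omega)) ▸ h2)⟩
  have hT : phaseStart x y b n = phaseStart x y b' n := phaseStart_congr h
  rw [← hT]
  refine alg.causal _ _ _ _ _ (fun i' s hs => ?_) fun s hs => ?_
  · refine if_congr ⟨?_, ?_⟩ rfl rfl
    · rintro ⟨m, rfl, hm⟩
      obtain ⟨h1, h2⟩ := key h hs
      exact ⟨m, h1, h2 i' hm⟩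
    · rintro ⟨m, rfl, hm⟩
      obtain ⟨h1, h2⟩ := key (fun m hm => (h m hm).symm) (hT ▸ hs)
      exact ⟨m, h1, h2 i' hm⟩
  · constructor
    · rintro ⟨m, rfl⟩
      exact ⟨m, (key h hs).1⟩
    · rintro ⟨m, rfl⟩
      exact ⟨m, (key (fun m hm => (h m hm).symm) (hT ▸ hs)).1⟩

end

/-- A sequence can be defined by a rule that determines each term from the earlier ones. -/
lemma exists_seq_of_causal (F : (ℕ → Bool) → ℕ → Bool)
    (hF : ∀ b b' n, (∀ m < n, b m = b' m) → F b n = F b' n) : ∃ b, ∀ n, b n = F b n := by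
  -- `B n` has the correct first `n` terms; the desired sequence is the diagonal.
  let B : ℕ → ℕ → Bool := fun n =>
    Nat.rec (fun _ => false) (fun n Bn => Function.update Bn n (F Bn n)) n
  have hB : ∀ n, B (n + 1) = Function.update (B n) n (F (B n) n) := fun n => rfl
  have hstab : ∀ m n, m < n → B n m = B (m + 1) m := by
    intro m n hmn
    induction n, Nat.succ_le_of_lt hmn using Nat.le_induction with
    | base => rfl
    | succ n hn ih =>
      rw [hB n, Function.update_of_ne (by omega)]
      exact ih hn
  refine ⟨fun n => B (n + 1) n, fun n => ?_⟩
  simp only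
  rw [hB n, Function.update_self]
  exact hF _ _ _ fun m hm => hstab m n hm

/-- The offline schedule that fills each phase of the adversary with a single packet. -/
def phaseSchedule (x y : ℝ) (i j : Fin k) (b : ℕ → Bool) : Starts k := fun t =>
  open Classical in
  if h : ∃ n, t = phaseStart x y b n then some (if b h.choose then j else i) else none

section

variable {ℓ : Fin k → ℝ} {i j : Fin k} (hj : 0 < ℓ j) (hji : ℓ j < ℓ i) (b : ℕ → Bool)

include hj hji in
lemma phaseSchedule_phaseStart (n : ℕ) :
    phaseSchedule (ℓ j) (ℓ i) i j b (phaseStart (ℓ j) (ℓ i) b n) =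
      some (if b n then j else i) := by
  have h : ∃ m, phaseStart (ℓ j) (ℓ i) b n = phaseStart (ℓ j) (ℓ i) b m := ⟨n, rfl⟩
  rw [phaseSchedule, dif_pos h, ← (strictMono_phaseStart hj hji).injective h.choose_spec]

lemma exists_of_phaseSchedule {t : ℝ} {i' : Fin k}
    (h : phaseSchedule (ℓ j) (ℓ i) i j b t = some i') : ∃ n, t = phaseStart (ℓ j) (ℓ i) b n := by
  by_contra h1
  rw [phaseSchedule, dif_neg h1] at h
  cases h

lemma phaseStart_add_length (n : ℕ) :
    phaseStart (ℓ j) (ℓ i) b n + ℓ (if b n then j else i) = phaseStart (ℓ j) (ℓ i) b (n + 1) := by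
  rw [phaseStart_succ]
  split_ifs <;> rfl

lemma sentBy_phaseSchedule (i' : Fin k) (n : ℕ) :
    sentBy ℓ (phaseErrors hj hji b) (phaseSchedule (ℓ j) (ℓ i) i j b) i'
        (phaseStart (ℓ j) (ℓ i) b n) =
      ((Finset.range n).filter fun m => (if b m then j else i) = i').card := by
  have hmono := strictMono_phaseStart (b := b) hj hji
  rw [← Finset.card_image_of_injective _ hmono.injective, ← Set.ncard_coe_finset, sentBy_eq_ncard]
  congr 1
  ext s
  simp only [Finset.coe_image, Finset.coe_filter, Finset.mem_range, Set.mem_image]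
  constructor
  · rintro ⟨h1, h2, _⟩
    obtain ⟨m, rfl⟩ := exists_of_phaseSchedule b h1
    rw [phaseSchedule_phaseStart hj hji, Option.some.injEq] at h1
    rw [← h1, phaseStart_add_length] at h2
    exact ⟨m, ⟨hmono.le_iff_le.1 h2, h1⟩, rfl⟩
  · rintro ⟨m, ⟨h1, h2⟩, rfl⟩
    refine ⟨by rw [phaseSchedule_phaseStart hj hji, h2], ?_, ?_⟩
    · rw [← h2, phaseStart_add_length]
      exact hmono.monotone h1
    · rintro _ ⟨l, rfl⟩ ⟨h3, h4⟩
      rw [← h2, phaseStart_add_length] at h4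
      have h5 := hmono.lt_iff_lt.1 h3
      have h6 := hmono.lt_iff_lt.1 h4
      omega

lemma throughput_phaseSchedule (n : ℕ) :
    throughput ℓ (phaseErrors hj hji b) (phaseSchedule (ℓ j) (ℓ i) i j b)
      (phaseStart (ℓ j) (ℓ i) b n) = phaseStart (ℓ j) (ℓ i) b n := by
  unfold throughput
  simp only [sentBy_phaseSchedule, Finset.card_filter]
  push_cast
  simp only [Finset.mul_sum]
  rw [Finset.sum_comm, phaseStart]
  refine Finset.sum_congr rfl fun m _ => ?_
  simp only [mul_ite, mul_one, mul_zero, Finset.sum_ite_eq, Finset.mem_univ, if_true]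
  split_ifs <;> rfl

/-- One short packet is present initially and each short phase is followed by the arrival of
another; a long packet arrives in every phase. So the packet needed is always there. -/
lemma isSchedule_phaseSchedule :
    IsSchedule ℓ (phaseArrivals hj hji i j b) (phaseErrors hj hji b)
      (phaseSchedule (ℓ j) (ℓ i) i j b) where
  available := by
    intro t i' ht
    have hne : j ≠ i := fun h => hji.ne (congrArg ℓ h)
    obtain ⟨n, rfl⟩ := exists_of_phaseSchedule b ht
    rw [phaseSchedule_phaseStart hj hji, Option.some.injEq] at ht
    rw [sentBy_phaseSchedule]
    by_cases hb : b n = true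
    · rw [if_pos hb] at ht
      subst ht
      rw [arrivedBy_phaseArrivals_short hj hji b hne, Nat.lt_succ_iff, Finset.card_filter,
        shortPhases]
      refine Finset.sum_le_sum fun m _ => ?_
      by_cases hm : b m = true
      · simp [hm]
      · simp [hm, hne.symm]
    · rw [if_neg hb] at ht
      subst ht
      rw [arrivedBy_phaseArrivals_long, Nat.lt_succ_iff]
      exact (Finset.card_filter_le _ _).trans (Finset.card_range n).le
  sequential := by
    intro s t i' hst hs ht
    obtain ⟨m, rfl⟩ := exists_of_phaseSchedule b hs
    obtain ⟨i'', hi''⟩ := Option.ne_none_iff_exists'.1 ht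
    obtain ⟨n, rfl⟩ := exists_of_phaseSchedule b hi''
    rw [phaseSchedule_phaseStart hj hji, Option.some.injEq] at hs
    left
    rw [← hs, phaseStart_add_length]
    have hmono := strictMono_phaseStart (b := b) hj hji
    exact hmono.monotone (hmono.lt_iff_lt.1 hst)

/-! ### An online schedule against the adversary -/

variable {b} {σ : Starts k} (hpos : ∀ i, 0 < ℓ i)
  (hσ : IsSchedule ℓ (phaseArrivals hj hji i j b) (phaseErrors hj hji b) σ)
  (hb : ∀ n, b n = true ↔ σ (phaseStart (ℓ j) (ℓ i) b n) = some i)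
include hσ hb

/-- Against the adversary no long packet is ever completed. -/
lemma completed_long_eq_empty (t : ℝ) : completed ℓ (phaseErrors hj hji b) σ i t = ∅ := by
  rw [Set.eq_empty_iff_forall_notMem]
  rintro s ⟨hs, _, hc⟩
  obtain ⟨n, h1, h2⟩ := exists_mem_phase (b := b) hj hji (hσ.start_nonneg hs)
  refine hc _ ⟨n + 1, rfl⟩ ⟨h2, ?_⟩
  rw [phaseStart_succ]
  rcases h1.eq_or_lt with h3 | h3
  · rw [if_pos ((hb n).2 (h3 ▸ hs))]
    linarith
  · split_ifs <;> linarith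

include hpos

/-- A short phase is wasted on a broken long packet, and at most `⌊ℓ i / ℓ j⌋₊` short packets fit
into a long phase. -/
lemma sentBy_short_le (n : ℕ) :
    sentBy ℓ (phaseErrors hj hji b) σ j (phaseStart (ℓ j) (ℓ i) b n) ≤
      ⌊ℓ i / ℓ j⌋₊ * longPhases b n := by
  induction n with
  | zero =>
    rw [hσ.sentBy_nonpos hpos j (le_of_eq (by simp [phaseStart]))]
    exact Nat.zero_le _
  | succ n ih =>
    have hle := (strictMono_phaseStart (b := b) hj hji).monotone n.le_succ
    rw [longPhases, Finset.sum_range_succ, ← longPhases]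
    by_cases hbn : b n = true
    · rw [if_pos hbn, add_zero]
      refine le_trans ?_ ih
      refine Set.ncard_le_ncard ?_ (hσ.finite_completed hpos j _)
      rintro s ⟨h1, h2, h3⟩
      -- The phase lasts `ℓ j`, so a short packet completed by its end was started no later than its
      -- beginning. Equality is excluded because a long packet starts at that moment.
      rw [phaseStart_succ, if_pos hbn, add_le_add_iff_right] at h2
      rcases h2.eq_or_lt with rfl | h4
      · rw [(hb n).1 hbn, Option.some.injEq] at h1
        exact absurd (congrArg ℓ h1) hji.ne'
      · exact ⟨h1, hσ.end_le_start h1 h3 h4 (by rw [(hb n).1 hbn]; simp), h3⟩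
    · have h1 := hσ.sum_sentIn_le_of_fresh hpos {j} hle (Or.inr ⟨n, rfl⟩)
      rw [Finset.sum_singleton, Nat.succ_eq_add_one, phaseStart_succ, if_neg hbn,
        add_sub_cancel_left, mul_comm, ← le_div_iff₀ hj] at h1
      have h2 := Nat.le_floor h1
      have h3 := hσ.sentBy_add_sentIn hpos j hle
      rw [Nat.succ_eq_add_one, phaseStart_succ, if_neg hbn] at h3
      rw [if_neg hbn, phaseStart_succ, if_neg hbn, mul_add, mul_one]
      omega

/-- Combine the number of arrived short packets, with weight `⌊ℓ i / ℓ j⌋₊`, and `sentBy_short_le`,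
with weight `ℓ i / ℓ j`: the two right-hand sides add up to a multiple of the elapsed time, apart
from the initial short packet. -/
lemma throughput_phase_le (n : ℕ) :
    throughput ℓ (phaseErrors hj hji b) σ (phaseStart (ℓ j) (ℓ i) b n) ≤
      (⌊ℓ i / ℓ j⌋₊ : ℝ) / (⌊ℓ i / ℓ j⌋₊ + ℓ i / ℓ j) *
        (phaseStart (ℓ j) (ℓ i) b n + ℓ j) := by
  have hne : j ≠ i := fun h => hji.ne (congrArg ℓ h)
  set T := phaseStart (ℓ j) (ℓ i) b n with hT
  set a := sentBy ℓ (phaseErrors hj hji b) σ j T with ha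
  have h1 : throughput ℓ (phaseErrors hj hji b) σ T = ℓ j * a := by
    refine Finset.sum_eq_single j (fun i' _ hi' => ?_) (by simp)
    by_cases h : i' = i
    · rw [h, sentBy_eq_ncard, completed_long_eq_empty hj hji hσ hb]
      simp
    · have := hσ.sentBy_le_arrivedBy hpos i' T
      rw [hT, arrivedBy_phaseArrivals_other hj hji b h hi', ← hT, Nat.le_zero] at this
      rw [this]
      simp
  have h2 : (a : ℝ) ≤ shortPhases b n + 1 := by
    have := hσ.sentBy_le_arrivedBy hpos j T
    rw [hT, arrivedBy_phaseArrivals_short hj hji b hne, ← hT] at this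
    exact_mod_cast this
  have h3 : (a : ℝ) ≤ ⌊ℓ i / ℓ j⌋₊ * longPhases b n := by
    exact_mod_cast sentBy_short_le hj hji hpos hσ hb n
  have hi : 0 < ℓ i := hpos i
  have hden : (0 : ℝ) < ⌊ℓ i / ℓ j⌋₊ + ℓ i / ℓ j := by positivity
  have h4 : T = shortPhases b n * ℓ j + longPhases b n * ℓ i := phaseStart_eq b n
  rw [h1, div_mul_eq_mul_div, le_div_iff₀ hden, h4]
  have h5 : ℓ j * (ℓ i / ℓ j) = ℓ i := mul_div_cancel₀ _ hj.ne'
  calc ℓ j * (a : ℝ) * (⌊ℓ i / ℓ j⌋₊ + ℓ i / ℓ j)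
      = ⌊ℓ i / ℓ j⌋₊ * (a * ℓ j) + a * (ℓ j * (ℓ i / ℓ j)) := by ring
    _ ≤ ⌊ℓ i / ℓ j⌋₊ * ((shortPhases b n + 1) * ℓ j) +
        (⌊ℓ i / ℓ j⌋₊ * longPhases b n) * ℓ i := by
        rw [h5]
        gcongr
    _ = _ := by ring

end

lemma relativeThroughput_le {ℓ : Fin k → ℝ} (hpos : ∀ i, 0 < ℓ i) {i j : Fin k}
    (hji : ℓ j < ℓ i) (alg : OnlineAlgorithm ℓ) :
    relativeThroughput ℓ alg ≤
      ENNReal.ofReal ((⌊ℓ i / ℓ j⌋₊ : ℝ) / (⌊ℓ i / ℓ j⌋₊ + ℓ i / ℓ j)) := by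
  classical
  have hj := hpos j
  obtain ⟨b, hb⟩ := exists_seq_of_causal
    (fun b n => decide (alg.run (phaseArrivals hj hji i j b) (phaseErrors hj hji b)
      (phaseStart (ℓ j) (ℓ i) b n) = some i))
    fun b b' n h => by
      rw [run_phase_congr hj hji alg h]
  have hb' : ∀ n, b n = true ↔ alg.run (phaseArrivals hj hji i j b) (phaseErrors hj hji b)
      (phaseStart (ℓ j) (ℓ i) b n) = some i := fun n => by
    rw [hb n, decide_eq_true_iff]
  set T := phaseStart (ℓ j) (ℓ i) b with hT
  set R := (⌊ℓ i / ℓ j⌋₊ : ℝ) / (⌊ℓ i / ℓ j⌋₊ + ℓ i / ℓ j) with hR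
  have hTlim : Filter.Tendsto T Filter.atTop Filter.atTop :=
    Filter.tendsto_atTop_mono (nat_mul_le_phaseStart hji)
      (tendsto_natCast_atTop_atTop.atTop_mul_const hj)
  have hunb : ¬ BddAbove (Set.range (throughput ℓ (phaseErrors hj hji b)
      (phaseSchedule (ℓ j) (ℓ i) i j b))) := by
    rintro ⟨B, hB⟩
    obtain ⟨n, hn⟩ := (hTlim.eventually_gt_atTop B).exists
    have := hB ⟨T n, rfl⟩
    rw [throughput_phaseSchedule] at this
    linarith
  unfold relativeThroughput
  refine iInf_le_of_le (phaseArrivals hj hji i j b) ?_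
  refine iInf_le_of_le (phaseErrors hj hji b) ?_
  refine iInf_le_of_le (phaseSchedule (ℓ j) (ℓ i) i j b) ?_
  refine iInf_le_of_le (isSchedule_phaseSchedule hj hji b) (iInf_le_of_le hunb ?_)
  -- Restricting to the phase starts can only increase the liminf, and there the offline throughput
  -- equals the elapsed time.
  refine (Filter.liminf_le_liminf_of_le hTlim).trans ?_
  have hlim : Filter.Tendsto (fun n => ENNReal.ofReal (R * (1 + ℓ j / T n))) Filter.atTop
      (nhds (ENNReal.ofReal R)) := by
    refine ENNReal.tendsto_ofReal ?_
    have h1 := (hTlim.const_div_atTop (ℓ j)).const_add 1 |>.const_mul R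
    simpa using h1
  rw [← hlim.liminf_eq]
  change Filter.liminf (fun n => throughputRatio
    (throughput ℓ (phaseErrors hj hji b) (alg.run (phaseArrivals hj hji i j b)
      (phaseErrors hj hji b)) (T n)) (throughput ℓ (phaseErrors hj hji b)
      (phaseSchedule (ℓ j) (ℓ i) i j b) (T n))) Filter.atTop ≤ _
  refine Filter.liminf_le_liminf ?_
  filter_upwards [hTlim.eventually_gt_atTop 0] with n hn
  rw [throughput_phaseSchedule, ← hT, throughputRatio, if_neg (fun h => hn.ne' h.2),
    ← ENNReal.ofReal_div_of_pos hn]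
  refine ENNReal.ofReal_le_ofReal ?_
  rw [div_le_iff₀ hn]
  refine (throughput_phase_le hj hji hpos (alg.isSchedule _ _) hb' n).trans_eq ?_
  rw [mul_assoc, add_mul, one_mul, div_mul_cancel₀ _ hn.ne']

end PacketScheduling

end

/-! ### Attaining the bound -/

namespace PacketScheduling

variable {k : ℕ} {ℓ : Fin k → ℝ}

/-- A monotone unbounded offline throughput tends to infinity, so an additive constant does not
affect the ratio in the limit. -/
lemma le_relativeThroughput (hpos : ∀ i, 0 < ℓ i) (alg : OnlineAlgorithm ℓ) {R C : ℝ}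
    (h : ∀ A E off, IsSchedule ℓ A E off → ∀ t, 0 ≤ t →
      R * throughput ℓ E off t ≤ throughput ℓ E (alg.run A E) t + C) :
    ENNReal.ofReal R ≤ relativeThroughput ℓ alg := by
  unfold relativeThroughput
  refine le_iInf fun A => le_iInf fun E => le_iInf fun off => le_iInf fun hoff =>
    le_iInf fun hunb => ?_
  have htop : Filter.Tendsto (throughput ℓ E off) Filter.atTop Filter.atTop :=
    Filter.tendsto_atTop_atTop_of_monotone' (hoff.throughput_mono hpos) hunb
  have hlim : Filter.Tendsto (fun t => ENNReal.ofReal (R - C / throughput ℓ E off t)) Filter.atTop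
      (nhds (ENNReal.ofReal R)) := by
    refine ENNReal.tendsto_ofReal ?_
    simpa using (htop.const_div_atTop C).const_sub R
  rw [← hlim.liminf_eq]
  refine Filter.liminf_le_liminf ?_
  filter_upwards [htop.eventually_gt_atTop 0, Filter.eventually_ge_atTop 0] with t ht ht0
  rw [throughputRatio, if_neg (fun h => ht.ne' h.2), ← ENNReal.ofReal_div_of_pos ht]
  refine ENNReal.ofReal_le_ofReal ?_
  rw [le_div_iff₀ ht, sub_mul, div_mul_cancel₀ _ ht.ne']
  linarith [h A E off hoff t ht0]

lemma exists_le_relativeThroughput (hk : 0 < k) (hpos : ∀ i, 0 < ℓ i) (hmono : StrictMono ℓ)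
    {c : ℝ} (hc0 : 0 < c) (hc1 : c ≤ 1) (hc : ∀ j i, j ≤ i → c * ℓ i ≤ ⌊ℓ i / ℓ j⌋₊ * ℓ j) :
    ∃ alg : OnlineAlgorithm ℓ, ENNReal.ofReal (c / (1 + c)) ≤ relativeThroughput ℓ alg := by
  obtain ⟨N, hN, hG⟩ := exists_block_sizes hk hpos hmono hc0 hc1 hc
  have hle : ∀ i, ℓ ⟨0, hk⟩ ≤ ℓ i := fun i => hmono.monotone (Fin.le_def.2 (Nat.zero_le _))
  have hsum : ∀ f : Fin k → ℝ, (∀ i, 0 ≤ f i) → ∀ i, f i ≤ ∑ i, f i := fun f hf i =>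
    Finset.single_le_sum (fun i _ => hf i) (Finset.mem_univ i)
  refine ⟨blockAlgorithm ℓ _ N (hpos ⟨0, hk⟩) hle hN, le_relativeThroughput hpos _
    (C := k * (∑ i, ℓ i * N i + (ℓ ⟨0, hk⟩ + 2 * ∑ i, ℓ i)) / (1 + c))
    fun A E off hoff t ht => ?_⟩
  have h1 := blockRun_competitive (A := A) (E := E) (hpos ⟨0, hk⟩) hle hN hc0 hc1 hG
    (hsum ℓ fun i => (hpos i).le) (Finset.sum_nonneg fun i _ => (hpos i).le)
    (hsum (fun i => ℓ i * N i) fun i => mul_nonneg (hpos i).le (Nat.cast_nonneg _)) hoff k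
    Finset.univ (by simp) t ht
  rw [throughputOn_univ, throughputOn_univ] at h1
  have h2 : 0 < 1 + c := by linarith
  rw [div_mul_eq_mul_div, div_le_iff₀ h2, add_mul, div_mul_cancel₀ _ h2.ne']
  change _ ≤ throughput ℓ E (blockRun ℓ (ℓ ⟨0, hk⟩) N A E) t * (1 + c) + _
  linarith

end PacketScheduling

theorem mainTheorem1 {k : ℕ} (hk : 2 ≤ k) (ℓ : Fin k → ℝ) (hpos : ∀ i, 0 < ℓ i)
    (hmono : StrictMono ℓ) :
    IsGreatest
      (Set.range fun alg : PacketScheduling.OnlineAlgorithm ℓ =>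
        PacketScheduling.relativeThroughput ℓ alg)
      (ENNReal.ofReal
        (⨅ p : {p : Fin k × Fin k // p.2 < p.1},
          (⌊ℓ p.1.1 / ℓ p.1.2⌋₊ : ℝ) / ((⌊ℓ p.1.1 / ℓ p.1.2⌋₊ : ℝ) + ℓ p.1.1 / ℓ p.1.2))) := by
  let f : {p : Fin k × Fin k // p.2 < p.1} → ℝ := fun p =>
    (⌊ℓ p.1.1 / ℓ p.1.2⌋₊ : ℝ) / ((⌊ℓ p.1.1 / ℓ p.1.2⌋₊ : ℝ) + ℓ p.1.1 / ℓ p.1.2)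
  change IsGreatest _ (ENNReal.ofReal (⨅ p, f p))
  have : Nonempty {p : Fin k × Fin k // p.2 < p.1} :=
    ⟨⟨(⟨1, by omega⟩, ⟨0, by omega⟩), Fin.lt_def.2 Nat.zero_lt_one⟩⟩
  obtain ⟨p₀, hp₀⟩ := exists_eq_ciInf_of_finite (f := f)
  have hfloor : ∀ j i, j ≤ i → (1 : ℝ) ≤ ⌊ℓ i / ℓ j⌋₊ := fun j i hji => by
    have : 1 ≤ ⌊ℓ i / ℓ j⌋₊ := by
      rw [Nat.one_le_floor_iff, one_le_div (hpos j)]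
      exact hmono.monotone hji
    exact_mod_cast this
  have hupper : ∀ alg : PacketScheduling.OnlineAlgorithm ℓ,
      PacketScheduling.relativeThroughput ℓ alg ≤ ENNReal.ofReal (⨅ p, f p) := fun alg => by
    rw [← hp₀]
    exact PacketScheduling.relativeThroughput_le hpos (hmono p₀.2) alg
  refine ⟨?_, ?_⟩
  swap
  · rintro _ ⟨alg, rfl⟩
    exact hupper alg
  set R := ⨅ p, f p with hR
  have hle : ∀ p, R ≤ f p := fun p => ciInf_le (Set.finite_range f).bddBelow p
  have hR0 : 0 < R := by
    rw [← hp₀]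
    have h1 := hfloor _ _ p₀.2.le
    have h2 := div_pos (hpos p₀.1.1) (hpos p₀.1.2)
    exact div_pos (by linarith) (by linarith)
  -- Since `⌊ρ⌋ ≤ ρ`, each value is at most `1 / 2`; this is what gives `c ≤ 1`.
  have hR1 : R ≤ 1 / 2 := by
    refine (hle p₀).trans ?_
    have h1 := hfloor _ _ p₀.2.le
    have h2 := div_pos (hpos p₀.1.1) (hpos p₀.1.2)
    have h3 := Nat.floor_le h2.le
    rw [div_le_div_iff₀ (by linarith) two_pos]
    linarith
  have hR2 : 0 < 1 - R := by linarith
  have hc1 : R / (1 - R) ≤ 1 := by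
    rw [div_le_one hR2]
    linarith
  -- This `c` solves `c / (1 + c) = R`.
  obtain ⟨alg, halg⟩ := PacketScheduling.exists_le_relativeThroughput (c := R / (1 - R))
    (by omega) hpos hmono (div_pos hR0 hR2) hc1 fun j i hji => by
      rcases hji.eq_or_lt with rfl | hlt
      · rw [div_self (hpos j).ne', Nat.floor_one, Nat.cast_one]
        exact mul_le_mul_of_nonneg_right hc1 (hpos j).le
      · have h1 := hle ⟨(i, j), hlt⟩
        have h2 := div_pos (hpos i) (hpos j)
        have h3 := hfloor j i hji
        simp only [f] at h1
        rw [le_div_iff₀ (by linarith)] at h1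
        have h4 : R / (1 - R) * (ℓ i / ℓ j) ≤ ⌊ℓ i / ℓ j⌋₊ := by
          rw [div_mul_eq_mul_div, div_le_iff₀ hR2]
          linarith
        calc R / (1 - R) * ℓ i = R / (1 - R) * (ℓ i / ℓ j) * ℓ j := by
              rw [mul_assoc, div_mul_cancel₀ _ (hpos j).ne']
          _ ≤ _ := mul_le_mul_of_nonneg_right h4 (hpos j).le
  refine ⟨alg, le_antisymm (hupper alg) (le_trans (le_of_eq ?_) halg)⟩
  congr 1
  field_simp
  ring
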